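/- Let $d\ge 1$ and let $e^{it\Delta}$ denote the free Schrödinger propagator on $L^2(\mathbb R^d)$, i.e. the Fourier multiplier with symbol $e^{-it|\xi|^2}$ (so $u(t)=e^{it\Delta}u_0$ solves $i\partial_t u+\Delta u=0$, $u(0)=u_0$). Put $$\|u\|_{L^q_tL^r_x}=\Bigl(\int_{\mathbb R}\Bigl(\int_{\mathbb R^d}|u(t,x)|^r\,dx\Bigr)^{q/r}dt\Bigr)^{1/q},$$ with the usual modification if an exponent is $\infty$. For $h_0>0$, $\xi_0,x_0\in\mathbb R^d$, $t_0\in\mathbb R$ and $\phi\in L^2(\mathbb R^d)$ let $$[g_{h_0,\xi_0,x_0,t_0}\phi](x)=e^{ix\cdot\xi_0}\,e^{-it_0\Delta}\Bigl[\tfrac1{h_0^{d/2}}\,\phi\bigl(\tfrac{\cdot-x_0}{h_0}\bigr)\Bigr](x).$$ Let $q,r\in[2,\infty]$ be Schrödinger admissible, i.e. $\frac2q+\frac dr=\frac d2$ and $(q,r,d)\ne(2,\infty,2)$, and non-endpoint, i.e. $(q,r)\neq(2,\frac{2d}{d-2})$ if $d\ge3$ and $(q,r)\ne(4,\infty)$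 if $d=1$. Let $N\ge1$, let $\phi^1,\dots,\phi^N\in L^2(\mathbb R^d)$, and let $\Gamma^j_n=(h^j_n,\xi^j_n,x^j_n,t^j_n)\in(0,\infty)\times\mathbb R^d\times\mathbb R^d\times\mathbb R$ ($1\le j\le N$, $n\ge1$) be sequences of parameters that are pairwise orthogonal: for all $j\ne k$, at least one of $$\lim_{n\to\infty}\Bigl(\frac{h^k_n}{h^j_n}+\frac{h^j_n}{h^k_n}+h^j_n|\xi^j_n-\xi^k_n|\Bigr)=\infty,$$ $$\lim_{n\to\infty}\Bigl(\frac{|t^j_n-t^k_n|}{(h^j_n)^2}+\Bigl|\frac{x^j_n-x^k_n}{h^j_n}+\frac{2t^k_n(\xi^j_n-\xi^k_n)}{h^j_n}\Bigr|\Bigr)=\infty$$ holds. Write $g^j_n=g_{h^j_n,\xi^j_n,x^j_n,t^j_n}$. If $q\ge r$, then $$\limsup_{n\to\infty}\Bigl\|\sum_{j=1}^N e^{it\Delta}g^j_n\phi^j\Bigr\|^r_{L^q_tL^r_x}\le\sum_{j=1}^N\|e^{it\Delta}\phi^j\|^r_{L^q_tL^r_x};$$ if $q\le r$, then $$\limsup_{n\to\infty}\Bigl\|\sum_{j=1}^N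 e^{it\Delta}g^j_n\phi^j\Bigr\|^q_{L^q_tL^r_x}\le\sum_{j=1}^N\|e^{it\Delta}\phi^j\|^q_{L^q_tL^r_x}.$$ -/

import Mathlib

open MeasureTheory Filter Topology
open scoped ENNReal FourierTransform

noncomputable section

namespace SchrodingerProfile

/-- Euclidean space `ℝ^d`. -/
abbrev Space (d : ℕ) : Type := EuclideanSpace ℝ (Fin d)

/-- The complex Hilbert space `L²(ℝ^d)`. -/
abbrev L2 (d : ℕ) : Type := Lp (α := Space d) ℂ 2 (volume : Measure (Space d))

theorem memLp_phase {d : ℕ} {a : Space d → ℝ} (ha : Continuous a) (f : L2 d) :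
    MemLp (fun x => Complex.exp (Complex.I * (a x : ℂ)) * f x) 2
      (volume : Measure (Space d)) := by
  have hc : Continuous fun x => Complex.exp (Complex.I * (a x : ℂ)) := by fun_prop
  refine (Lp.memLp f).congr_norm (hc.aestronglyMeasurable.mul (Lp.aestronglyMeasurable f)) ?_
  filter_upwards with x
  rw [norm_mul, mul_comm Complex.I, Complex.norm_exp_ofReal_mul_I, one_mul]

/-- Multiplication of `f ∈ L²` by the unimodular function `x ↦ e^{i a(x)}`. -/
def phaseMul {d : ℕ} (a : Space d → ℝ) (ha : Continuous a) (f : L2 d) : L2 d :=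
  (memLp_phase ha f).toLp _

theorem continuous_freePhase {d : ℕ} (t : ℝ) :
    Continuous fun η : Space d => -t * ‖(2 * Real.pi) • η‖ ^ 2 := by
  fun_prop

/-- The free Schrödinger propagator `e^{itΔ}` on `L²(ℝ^d)`: the Fourier multiplier with symbol
`e^{-it|ξ|²}`, where `ξ = 2πη` is the angular frequency belonging to the frequency variable `η`
of Mathlib's (unitary) Fourier transform. -/
def propagator {d : ℕ} (t : ℝ) (f : L2 d) : L2 d :=
  𝓕⁻ (phaseMul (fun η => -t * ‖(2 * Real.pi) • η‖ ^ 2) (continuous_freePhase t) (𝓕 f))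

/-- Parameters `(h, ξ, x, t)` in `(0,∞) × ℝ^d × ℝ^d × ℝ`. -/
structure Param (d : ℕ) where
  h : ℝ
  h_pos : 0 < h
  ξ : Space d
  x : Space d
  t : ℝ

theorem memLp_dilate {d : ℕ} {h : ℝ} (hh : 0 < h) (x₀ : Space d) (f : L2 d) :
    MemLp (fun x => ((1 / h ^ ((d : ℝ) / 2) : ℝ) : ℂ) * f (h⁻¹ • (x - x₀))) 2
      (volume : Measure (Space d)) := by
  refine MemLp.const_mul ?_ _
  have h0 : h⁻¹ ≠ 0 := inv_ne_zero hh.ne'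
  have h1 : MemLp (fun x : Space d => f (h⁻¹ • x)) 2 (volume : Measure (Space d)) := by
    have hm : MemLp f 2 (Measure.map (fun x : Space d => h⁻¹ • x) volume) := by
      rw [Measure.map_addHaar_smul _ h0]
      exact (Lp.memLp f).smul_measure ENNReal.ofReal_ne_top
    exact hm.comp_of_map (measurable_const_smul h⁻¹).aemeasurable
  exact h1.comp_measurePreserving (measurePreserving_sub_right volume x₀)

/-- The rescaled and translated function `h^{-d/2} f((· - x₀)/h)`. -/
def dilate {d : ℕ} (h : ℝ) (hh : 0 < h) (x₀ : Space d) (f : L2 d) : L2 d :=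
  (memLp_dilate hh x₀ f).toLp _

theorem continuous_modPhase {d : ℕ} (θ : ℝ) (ξ : Space d) :
    Continuous fun x : Space d => θ + inner ℝ x ξ := by
  fun_prop

/-- The mass-preserving symmetry
`g_{θ,h,ξ,x₀,t₀} φ (x) = e^{iθ} e^{i x·ξ} e^{-it₀Δ} [h^{-d/2} φ((· - x₀)/h)] (x)`. -/
def symm {d : ℕ} (θ : ℝ) (p : Param d) (φ : L2 d) : L2 d :=
  phaseMul (fun x => θ + inner ℝ x p.ξ) (continuous_modPhase θ p.ξ)
    (propagator (-p.t) (dilate p.h p.h_pos p.x φ))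

/-- Orthogonality of two sequences of parameters: the scales or frequencies separate, or the
space-time centres separate. The evolution `e^{itΔ} g φ` is centred at `x₀ + 2 t ξ` at time `t`,
so `x^j - x^k + 2 t^k (ξ^j - ξ^k)` is the distance of the two centres at time `t^k`. -/
def Orthogonal {d : ℕ} (Γj Γk : ℕ → Param d) : Prop :=
  Tendsto (fun n => (Γk n).h / (Γj n).h + (Γj n).h / (Γk n).h
      + (Γj n).h * ‖(Γj n).ξ - (Γk n).ξ‖) atTop atTop ∨
  Tendsto (fun n => |(Γj n).t - (Γk n).t| / (Γj n).h ^ 2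
      + ‖(Γj n).h⁻¹ • ((Γj n).x - (Γk n).x)
          + (2 * (Γk n).t / (Γj n).h) • ((Γj n).ξ - (Γk n).ξ)‖) atTop atTop

/-- Schrödinger admissible pairs in dimension `d`. -/
def Admissible (d : ℕ) (q r : ℝ≥0∞) : Prop :=
  2 / q + (d : ℝ≥0∞) / r = (d : ℝ≥0∞) / 2 ∧ ¬ (q = 2 ∧ r = ∞ ∧ d = 2) ∧ 2 ≤ q ∧ 2 ≤ r

/-- The endpoint pairs: `(2, 2d/(d-2))` for `d ≥ 3`, and `(4, ∞)` for `d = 1`. -/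
def IsEndpoint (d : ℕ) (q r : ℝ≥0∞) : Prop :=
  (3 ≤ d ∧ q = 2 ∧ r = 2 * (d : ℝ≥0∞) / ((d : ℝ≥0∞) - 2)) ∨ (d = 1 ∧ q = 4 ∧ r = ∞)

/-- The mixed norm `‖u‖_{L^q_t L^r_x(ℝ × ℝ^d)}`, with values in `[0, ∞]`. -/
def mixedNorm {d : ℕ} (q r : ℝ≥0∞) (u : ℝ → L2 d) : ℝ≥0∞ :=
  eLpNorm (fun t : ℝ => eLpNorm (u t) r (volume : Measure (Space d))) q volume

end SchrodingerProfile

end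

/-!
Decoupling of orthogonal profiles in mixed space-time norms.

Up to a phase, `e^{itΔ} g φ` is the evolution of `φ` transported by a parabolic dilation, a
space-time translation and a Galilean boost (`norm_propagator_symm_ae`). The phase plays no role
in an upper bound, so for finite exponents everything is read off the moduli `F_j(t, x) = |e^{itΔ}
φ_j(x)|`, on which an admissible mixed norm is invariant under transport
(`mixed_transport_of_admissible`). No Strichartz estimate is needed: if some `F_j` has infinite
norm there is nothing to prove, and otherwise `F_j` is approximated in `L^q_t L^r_x` by a
truncation, bounded and supported in `|t| ≤ R`, `‖x‖ ≤ R` (`tendsto_mixed_truncRest`). The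
transported truncation lives in a tube around a classical trajectory. If two parameters are far
apart, one of the two truncations is small where the tubes meet (`exists_gap_overlap_le`): either
one scale is much smaller than the other, or the relative velocity is so large that the tubes meet
for a short time only, or the tubes are disjoint. After removal of the overlaps the profiles have
disjoint supports, and for these the mixed norm to the power `min q r` is subadditive, by
Minkowski's inequality in `L^{q/r}` for `r ≤ q` and by subadditivity of `s ↦ s^{q/r}` for `q ≤ r`
(`mixed_sum_rpow_le`).

The remaining case `(q, r) = (∞, 2)` is asymptotic orthogonality of `g_n φ` and `g'_n ψ` in `L²`
(`tendsto_inner_symm`). Their inner product is conserved by the flow, hence equal to its average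
over a time interval of length `h²`, which is bounded by `h⁻² ∬ |e^{itΔ} g_n φ| |e^{itΔ} g'_n ψ|`
(`enorm_inner_symm_le_pairing`). If the evolution of `ψ` is in `L^p_{t,x}` with `p = 2 + 4/d`,
then truncation and the overlap estimate show that this tends to zero (`eventually_pairing_le`).
For Gaussians the evolution is explicit and lies in `L^p_{t,x}`, the modulus of the evolution of a
modulated Gaussian differs only by a translation, and the modulated Gaussians are total in `L²`
(`dense_gaussianSpan`).
-/

noncomputable section

namespace SchrodingerProfile

variable {d : ℕ}

/-! ### The Fourier transform and the symmetries on `L²` -/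

theorem integral_fourier_mul_eq {f g : Space d → ℂ} (hf : Integrable f) (hg : Integrable g) :
    ∫ x, 𝓕 f x * g x = ∫ x, f x * 𝓕 g x := by
  simpa using! (VectorFourier.integral_fourierIntegral_smul_eq_flip (L := innerₗ (Space d))
    Real.continuous_fourierChar continuous_inner hf hg)

theorem continuous_fourier {f : Space d → ℂ} (hi : Integrable f) : Continuous (𝓕 f) :=
  VectorFourier.fourierIntegral_continuous Real.continuous_fourierChar
    (by exact continuous_inner) hi

/-- The Fourier transform on `L²` is given by the integral on `L¹ ∩ L²`. Both sides are tested
against Schwartz functions. -/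
theorem fourier_toLp_ae {f : Space d → ℂ} (hf : MemLp f 2 (volume : Measure (Space d)))
    (hi : Integrable f) : (𝓕 (hf.toLp f) : L2 d) =ᵐ[volume] 𝓕 f := by
  refine ae_eq_of_integral_contDiff_smul_eq
    ((Lp.memLp _).locallyIntegrable (by norm_num)) (continuous_fourier hi).locallyIntegrable ?_
  intro g hg hgc
  set gc : SchwartzMap (Space d) ℂ :=
    (hgc.comp_left (g := ((↑) : ℝ → ℂ)) (by simp)).toSchwartzMap
      (Complex.ofRealCLM.contDiff.comp hg) with hgc_def
  have hgv : ∀ x, gc x = (g x : ℂ) := fun x => rfl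
  have h1 := congrArg (fun T => T gc) (Lp.fourier_toTemperedDistribution_eq (hf.toLp f))
  simp only [TemperedDistribution.fourier_apply, Lp.toTemperedDistribution_apply] at h1
  have h2 : ∫ x, (𝓕 gc : SchwartzMap (Space d) ℂ) x • (hf.toLp f) x
      = ∫ x, 𝓕 (gc : Space d → ℂ) x • f x := by
    refine integral_congr_ae ?_
    filter_upwards [hf.coeFn_toLp] with x hx
    rw [hx, SchwartzMap.fourier_coe]
  have h3 : ∫ x, 𝓕 (gc : Space d → ℂ) x • f x = ∫ x, gc x • 𝓕 f x :=
    integral_fourier_mul_eq gc.integrable hi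
  rw [h2, h3] at h1
  simp only [hgv] at h1
  simpa [Complex.real_smul] using h1.symm

theorem fourier_ae {f : L2 d} {F : Space d → ℂ} (hf : f =ᵐ[volume] F) (hi : Integrable F) :
    (𝓕 f : L2 d) =ᵐ[volume] 𝓕 F := by
  have hF : MemLp F 2 (volume : Measure (Space d)) := (memLp_congr_ae hf).1 (Lp.memLp f)
  have : f = hF.toLp F := Lp.ext (hf.trans hF.coeFn_toLp.symm)
  exact this ▸ fourier_toLp_ae hF hi

/-- The inverse Fourier transform on `L²` is given by the integral on `L¹ ∩ L²`. -/
theorem fourierInv_ae {f : L2 d} {F : Space d → ℂ} (hf : f =ᵐ[volume] F) (hi : Integrable F) :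
    (𝓕⁻ f : L2 d) =ᵐ[volume] fun x => 𝓕 F (-x) := by
  refine ae_eq_of_integral_contDiff_smul_eq
    ((Lp.memLp _).locallyIntegrable (by norm_num))
    ((continuous_fourier hi).comp continuous_neg).locallyIntegrable ?_
  intro g hg hgc
  set gc : SchwartzMap (Space d) ℂ :=
    (hgc.comp_left (g := ((↑) : ℝ → ℂ)) (by simp)).toSchwartzMap
      (Complex.ofRealCLM.contDiff.comp hg) with hgc_def
  have hgv : ∀ x, gc x = (g x : ℂ) := fun x => rfl
  have h1 := congrArg (fun T => T gc) (Lp.fourierInv_toTemperedDistribution_eq f)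
  simp only [TemperedDistribution.fourierInv_apply, Lp.toTemperedDistribution_apply] at h1
  have h2 : ∫ x, (𝓕⁻ gc : SchwartzMap (Space d) ℂ) x • f x
      = ∫ x, 𝓕 (fun y => gc (-y)) x * F x := by
    refine integral_congr_ae ?_
    filter_upwards [hf] with x hx
    rw [hx, SchwartzMap.fourierInv_coe, Real.fourierInv_eq_fourier_comp_neg]
    rfl
  have h3 : ∫ x, 𝓕 (fun y => gc (-y)) x * F x = ∫ x, gc (-x) * 𝓕 F x :=
    integral_fourier_mul_eq gc.integrable.comp_neg hi
  have h4 : ∫ x, gc (-x) * 𝓕 F x = ∫ x, gc x * 𝓕 F (-x) := by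
    rw [← integral_neg_eq_self]
    simp
  rw [h2, h3, h4] at h1
  simp only [hgv] at h1
  simpa [Complex.real_smul] using h1.symm

theorem phaseMul_ae {a : Space d → ℝ} (ha : Continuous a) (f : L2 d) :
    phaseMul a ha f =ᵐ[volume] fun x => Complex.exp (Complex.I * (a x : ℂ)) * f x :=
  (memLp_phase ha f).coeFn_toLp

theorem dilate_ae {h : ℝ} (hh : 0 < h) (x₀ : Space d) (f : L2 d) :
    dilate h hh x₀ f =ᵐ[volume]
      fun x => ((1 / h ^ ((d : ℝ) / 2) : ℝ) : ℂ) * f (h⁻¹ • (x - x₀)) :=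
  (memLp_dilate hh x₀ f).coeFn_toLp

theorem quasiMeasurePreserving_affine {h : ℝ} (hh : 0 < h) (x₀ : Space d) :
    Measure.QuasiMeasurePreserving (fun x : Space d => h⁻¹ • (x - x₀)) volume volume := by
  have h1 : Measure.QuasiMeasurePreserving (fun x : Space d => h⁻¹ • x) volume volume := by
    refine ⟨measurable_const_smul _, ?_⟩
    rw [Measure.map_addHaar_smul _ (inv_ne_zero hh.ne')]
    exact Measure.smul_absolutelyContinuous
  exact h1.comp (measurePreserving_sub_right volume x₀).quasiMeasurePreserving

/-- `L^p` norms under affine changes of variables. -/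
theorem eLpNorm_comp_affine {E : Type*} [NormedAddCommGroup E] [NormedSpace ℝ E]
    [MeasurableSpace E] [BorelSpace E] [FiniteDimensional ℝ E] (μ : Measure E)
    [μ.IsAddHaarMeasure] {ε : Type*} [TopologicalSpace ε] [ContinuousENorm ε]
    {p : ℝ≥0∞} (hp : p ≠ ∞) {h : ℝ} (hh : 0 < h) (x₀ : E) {f : E → ε}
    (hf : AEStronglyMeasurable f μ) :
    eLpNorm (fun x => f (h⁻¹ • (x - x₀))) p μ
      = ENNReal.ofReal (h ^ ((Module.finrank ℝ E : ℝ) / p.toReal)) * eLpNorm f p μ := by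
  have h0 : h⁻¹ ≠ 0 := inv_ne_zero hh.ne'
  have hmap := Measure.map_addHaar_smul μ h0
  have hf' : AEStronglyMeasurable f (Measure.map (fun x : E => h⁻¹ • x) μ) := by
    rw [hmap]
    exact hf.smul_measure _
  have h1 : eLpNorm (fun x => f (h⁻¹ • x)) p μ
      = eLpNorm f p (Measure.map (fun x : E => h⁻¹ • x) μ) :=
    (eLpNorm_map_measure hf' (measurable_const_smul h⁻¹).aemeasurable).symm
  have h2 : AEStronglyMeasurable (fun x => f (h⁻¹ • x)) μ :=
    hf'.comp_measurable (measurable_const_smul h⁻¹)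
  have h3 := eLpNorm_comp_measurePreserving (p := p) h2 (measurePreserving_sub_right μ x₀)
  calc _ = eLpNorm (fun x => f (h⁻¹ • x)) p μ := h3
    _ = _ := by
      rw [h1, hmap, eLpNorm_smul_measure_of_ne_top hp, smul_eq_mul]
      congr 1
      rw [ENNReal.ofReal_rpow_of_nonneg (abs_nonneg _) ENNReal.toReal_nonneg, inv_pow, inv_inv,
        abs_of_pos (by positivity), ← Real.rpow_natCast, ← Real.rpow_mul hh.le]
      congr 2
      simp [div_eq_mul_inv]

theorem fourier_modulate_apply (f : Space d → ℂ) (θ : ℝ) (ξ η : Space d) :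
    𝓕 (fun x => Complex.exp (Complex.I * ((θ + inner ℝ x ξ : ℝ) : ℂ)) * f x) η
      = Complex.exp (Complex.I * θ) * 𝓕 f (η - (2 * Real.pi)⁻¹ • ξ) := by
  simp only [Real.fourier_eq', smul_eq_mul]
  rw [← integral_const_mul]
  congr 1
  ext x
  rw [← mul_assoc, ← mul_assoc, ← Complex.exp_add, ← Complex.exp_add]
  congr 2
  rw [inner_sub_right, real_inner_smul_right]
  have := Real.pi_ne_zero
  push_cast
  have : (Real.pi : ℂ) ≠ 0 := by exact_mod_cast this
  field_simp
  ring

theorem fourier_dilate_apply (f : Space d → ℂ) {h : ℝ} (hh : 0 < h) (x₀ η : Space d) :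
    𝓕 (fun x => ((1 / h ^ ((d : ℝ) / 2) : ℝ) : ℂ) * f (h⁻¹ • (x - x₀))) η
      = Complex.exp (Complex.I * ((-(2 * Real.pi * inner ℝ η x₀) : ℝ) : ℂ)) *
        (((1 / h⁻¹ ^ ((d : ℝ) / 2) : ℝ) : ℂ) * 𝓕 f (h • η)) := by
  simp only [Real.fourier_eq', smul_eq_mul]
  have e1 := integral_sub_right_eq_self (μ := (volume : Measure (Space d)))
    (fun x => Complex.exp (((-2 * Real.pi * inner ℝ (x + x₀) η : ℝ) : ℂ) * Complex.I) *
      (((1 / h ^ ((d : ℝ) / 2) : ℝ) : ℂ) * f (h⁻¹ • x))) x₀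
  simp only [sub_add_cancel] at e1
  rw [e1]
  have e2 := Measure.integral_comp_inv_smul_of_nonneg (volume : Measure (Space d))
    (fun x => Complex.exp (((-2 * Real.pi * inner ℝ (h • x + x₀) η : ℝ) : ℂ) * Complex.I) *
      (((1 / h ^ ((d : ℝ) / 2) : ℝ) : ℂ) * f x)) hh.le
  simp only [smul_inv_smul₀ hh.ne'] at e2
  rw [e2, ← integral_const_mul, ← integral_const_mul, ← integral_smul]
  congr 1
  ext x
  rw [Complex.real_smul, inner_add_left, real_inner_smul_left, real_inner_smul_right,
    real_inner_comm x₀ η]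
  have e3 : Complex.exp (((-2 * Real.pi * (h * inner ℝ x η + inner ℝ x₀ η) : ℝ) : ℂ) * Complex.I)
      = Complex.exp (Complex.I * ((-(2 * Real.pi * inner ℝ x₀ η) : ℝ) : ℂ)) *
        Complex.exp (((-2 * Real.pi * (h * inner ℝ x η) : ℝ) : ℂ) * Complex.I) := by
    rw [← Complex.exp_add]
    congr 1
    push_cast
    ring
  have e4 : ((h ^ Module.finrank ℝ (Space d) : ℝ) : ℂ) * ((1 / h ^ ((d : ℝ) / 2) : ℝ) : ℂ)
      = ((1 / h⁻¹ ^ ((d : ℝ) / 2) : ℝ) : ℂ) := by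
    rw [← Complex.ofReal_mul]
    congr 1
    have : h ^ Module.finrank ℝ (Space d) = h ^ ((d : ℝ) / 2) * h ^ ((d : ℝ) / 2) := by
      rw [← Real.rpow_add hh, finrank_euclideanSpace_fin, ← Real.rpow_natCast]
      congr 1
      ring
    rw [this, Real.inv_rpow hh.le]
    have := (Real.rpow_pos_of_pos hh ((d : ℝ) / 2)).ne'
    field_simp
  rw [e3, ← e4]
  ring

/-- Multiplication by a phase as a linear isometry. -/
def phaseMulₗᵢ (a : Space d → ℝ) (ha : Continuous a) : L2 d →ₗᵢ[ℂ] L2 d where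
  toFun := phaseMul a ha
  map_add' f g := by
    refine Lp.ext ?_
    filter_upwards [phaseMul_ae ha (f + g), phaseMul_ae ha f, phaseMul_ae ha g,
      Lp.coeFn_add f g, Lp.coeFn_add (phaseMul a ha f) (phaseMul a ha g)] with x h1 h2 h3 h4 h5
    rw [h1, h4, h5, Pi.add_apply, Pi.add_apply, h2, h3, mul_add]
  map_smul' c f := by
    refine Lp.ext ?_
    filter_upwards [phaseMul_ae ha (c • f), phaseMul_ae ha f,
      Lp.coeFn_smul c f, Lp.coeFn_smul c (phaseMul a ha f)] with x h1 h2 h4 h5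
    rw [h1, h4, RingHom.id_apply, h5, Pi.smul_apply, Pi.smul_apply, h2, smul_eq_mul, smul_eq_mul]
    ring
  norm_map' f := by
    change ‖phaseMul a ha f‖ = ‖f‖
    rw [Lp.norm_def, Lp.norm_def]
    congr 1
    refine eLpNorm_congr_norm_ae ?_
    filter_upwards [phaseMul_ae ha f] with x h1
    rw [h1, norm_mul, mul_comm Complex.I, Complex.norm_exp_ofReal_mul_I, one_mul]

/-- Dilation and translation as a linear isometry. -/
def dilateₗᵢ (h : ℝ) (hh : 0 < h) (x₀ : Space d) : L2 d →ₗᵢ[ℂ] L2 d where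
  toFun := dilate h hh x₀
  map_add' f g := by
    refine Lp.ext ?_
    filter_upwards [dilate_ae hh x₀ (f + g), dilate_ae hh x₀ f, dilate_ae hh x₀ g,
      (quasiMeasurePreserving_affine hh x₀).ae (Lp.coeFn_add f g),
      Lp.coeFn_add (dilate h hh x₀ f) (dilate h hh x₀ g)] with x h1 h2 h3 h4 h5
    rw [h1, h4, h5, Pi.add_apply, Pi.add_apply, h2, h3, mul_add]
  map_smul' c f := by
    refine Lp.ext ?_
    filter_upwards [dilate_ae hh x₀ (c • f), dilate_ae hh x₀ f,
      (quasiMeasurePreserving_affine hh x₀).ae (Lp.coeFn_smul c f),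
      Lp.coeFn_smul c (dilate h hh x₀ f)] with x h1 h2 h4 h5
    rw [h1, h4, RingHom.id_apply, h5, Pi.smul_apply, Pi.smul_apply, h2, smul_eq_mul, smul_eq_mul]
    ring
  norm_map' f := by
    change ‖dilate h hh x₀ f‖ = ‖f‖
    rw [Lp.norm_def, Lp.norm_def]
    congr 1
    have hpos := Real.rpow_pos_of_pos hh ((d : ℝ) / 2)
    rw [eLpNorm_congr_ae (dilate_ae hh x₀ f)]
    have e := eLpNorm_const_smul ((1 / h ^ ((d : ℝ) / 2) : ℝ) : ℂ)
      (fun x : Space d => f (h⁻¹ • (x - x₀))) 2 volume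
    refine e.trans ?_
    rw [eLpNorm_comp_affine volume (by norm_num) hh x₀ (Lp.aestronglyMeasurable f), ← mul_assoc]
    have : ‖((1 / h ^ ((d : ℝ) / 2) : ℝ) : ℂ)‖ₑ *
        ENNReal.ofReal (h ^ ((Module.finrank ℝ (Space d) : ℝ) / (2 : ℝ≥0∞).toReal)) = 1 := by
      rw [← ofReal_norm, Complex.norm_real, Real.norm_of_nonneg (by positivity),
        ← ENNReal.ofReal_mul (by positivity)]
      simp [hpos.ne']
    rw [this, one_mul]

/-- The free propagator as a linear isometry. -/
def propagatorₗᵢ (t : ℝ) : L2 d →ₗᵢ[ℂ] L2 d :=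
  (Lp.fourierTransformₗᵢ (Space d) ℂ).symm.toLinearIsometry.comp
    ((phaseMulₗᵢ _ (continuous_freePhase t)).comp
      (Lp.fourierTransformₗᵢ (Space d) ℂ).toLinearIsometry)

/-- The symmetries of the equation as linear isometries. -/
def symmₗᵢ (θ : ℝ) (p : Param d) : L2 d →ₗᵢ[ℂ] L2 d :=
  (phaseMulₗᵢ _ (continuous_modPhase θ p.ξ)).comp
    ((propagatorₗᵢ (-p.t)).comp (dilateₗᵢ p.h p.h_pos p.x))

theorem fourier_propagator (t : ℝ) (f : L2 d) :
    𝓕 (propagator t f) = phaseMul _ (continuous_freePhase t) (𝓕 f) :=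
  FourierTransform.fourier_fourierInv_eq _

theorem fourier_injective {f g : L2 d} (h : 𝓕 f = 𝓕 g) : f = g :=
  (Lp.fourierTransformₗᵢ (Space d) ℂ).injective h

/-- Two linear isometries agree on `L²` if they agree on Schwartz functions. -/
theorem linearIsometry_ext_schwartz {A B : L2 d →ₗᵢ[ℂ] L2 d}
    (h : ∀ s : SchwartzMap (Space d) ℂ, A (s.toLp 2) = B (s.toLp 2)) (f : L2 d) : A f = B f := by
  refine DenseRange.induction_on (p := fun f => A f = B f)
    (SchwartzMap.denseRange_toLpCLM (E := Space d) (F := ℂ) (p := 2) (μ := volume)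
      ENNReal.ofNat_ne_top) f (isClosed_eq A.continuous B.continuous) h

theorem continuous_fourierTranslationPhase (x₀ : Space d) :
    Continuous fun η : Space d => -(2 * Real.pi * inner ℝ η x₀) := by
  fun_prop

theorem fourier_dilate {h : ℝ} (hh : 0 < h) (x₀ : Space d) (f : L2 d) :
    𝓕 (dilate h hh x₀ f) = phaseMul _ (continuous_fourierTranslationPhase x₀)
      (dilate h⁻¹ (inv_pos.2 hh) 0 (𝓕 f)) := by
  refine linearIsometry_ext_schwartz
    (A := (Lp.fourierTransformₗᵢ (Space d) ℂ).toLinearIsometry.comp (dilateₗᵢ h hh x₀))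
    (B := (phaseMulₗᵢ _ (continuous_fourierTranslationPhase x₀)).comp
      ((dilateₗᵢ h⁻¹ (inv_pos.2 hh) 0).comp
        (Lp.fourierTransformₗᵢ (Space d) ℂ).toLinearIsometry)) ?_ f
  intro s
  change 𝓕 (dilate h hh x₀ (s.toLp 2)) = phaseMul _ (continuous_fourierTranslationPhase x₀)
      (dilate h⁻¹ (inv_pos.2 hh) 0 (𝓕 (s.toLp 2)))
  have h0 : (s.toLp 2 : L2 d) =ᵐ[volume] s := s.coeFn_toLp 2 volume
  have h1 : dilate h hh x₀ (s.toLp 2) =ᵐ[volume]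
      fun x => ((1 / h ^ ((d : ℝ) / 2) : ℝ) : ℂ) * s (h⁻¹ • (x - x₀)) := by
    filter_upwards [dilate_ae hh x₀ (s.toLp 2), (quasiMeasurePreserving_affine hh x₀).ae h0]
      with x h1 h2
    rw [h1, h2]
  have h2 : (𝓕 (s.toLp 2) : L2 d) =ᵐ[volume] 𝓕 (s : Space d → ℂ) := fourier_ae h0 s.integrable
  refine Lp.ext ?_
  have hi : Integrable fun x => ((1 / h ^ ((d : ℝ) / 2) : ℝ) : ℂ) * s (h⁻¹ • (x - x₀)) :=
    ((s.integrable.comp_smul (inv_ne_zero hh.ne')).comp_sub_right x₀).const_mul _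
  filter_upwards [fourier_ae h1 hi, phaseMul_ae (continuous_fourierTranslationPhase x₀)
    (dilate h⁻¹ (inv_pos.2 hh) 0 (𝓕 (s.toLp 2))), dilate_ae (inv_pos.2 hh) 0 (𝓕 (s.toLp 2)),
    (quasiMeasurePreserving_affine (inv_pos.2 hh) (0 : Space d)).ae h2] with η e1 e2 e3 e4
  rw [e1, e2, e3, e4, fourier_dilate_apply _ hh]
  simp

theorem fourier_modulate (θ : ℝ) (ξ : Space d) (f : L2 d) :
    𝓕 (phaseMul _ (continuous_modPhase θ ξ) f) = phaseMul (fun _ => θ) continuous_const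
      (dilate 1 one_pos ((2 * Real.pi)⁻¹ • ξ) (𝓕 f)) := by
  refine linearIsometry_ext_schwartz
    (A := (Lp.fourierTransformₗᵢ (Space d) ℂ).toLinearIsometry.comp
      (phaseMulₗᵢ _ (continuous_modPhase θ ξ)))
    (B := (phaseMulₗᵢ (fun _ => θ) continuous_const).comp
      ((dilateₗᵢ 1 one_pos ((2 * Real.pi)⁻¹ • ξ)).comp
        (Lp.fourierTransformₗᵢ (Space d) ℂ).toLinearIsometry)) ?_ f
  intro s
  change 𝓕 (phaseMul _ (continuous_modPhase θ ξ) (s.toLp 2)) =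
    phaseMul (fun _ => θ) continuous_const
      (dilate 1 one_pos ((2 * Real.pi)⁻¹ • ξ) (𝓕 (s.toLp 2)))
  have h0 : (s.toLp 2 : L2 d) =ᵐ[volume] s := s.coeFn_toLp 2 volume
  have h1 : phaseMul _ (continuous_modPhase θ ξ) (s.toLp 2) =ᵐ[volume]
      fun x => Complex.exp (Complex.I * ((θ + inner ℝ x ξ : ℝ) : ℂ)) * s x := by
    filter_upwards [phaseMul_ae (continuous_modPhase θ ξ) (s.toLp 2), h0] with x h1 h2
    rw [h1, h2]
  have h2 : (𝓕 (s.toLp 2) : L2 d) =ᵐ[volume] 𝓕 (s : Space d → ℂ) := fourier_ae h0 s.integrable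
  refine Lp.ext ?_
  have hi : Integrable
      fun x => Complex.exp (Complex.I * ((θ + inner ℝ x ξ : ℝ) : ℂ)) * s x := by
    refine s.integrable.congr' (by fun_prop) (ae_of_all _ fun x => ?_)
    rw [norm_mul, mul_comm Complex.I, Complex.norm_exp_ofReal_mul_I, one_mul]
  filter_upwards [fourier_ae h1 hi, phaseMul_ae (a := fun _ => θ) continuous_const
    (dilate 1 one_pos ((2 * Real.pi)⁻¹ • ξ) (𝓕 (s.toLp 2))),
    dilate_ae one_pos ((2 * Real.pi)⁻¹ • ξ) (𝓕 (s.toLp 2)),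
    (quasiMeasurePreserving_affine one_pos ((2 * Real.pi)⁻¹ • ξ)).ae h2] with η e1 e2 e3 e4
  rw [e1, e2, e3, e4, fourier_modulate_apply]
  simp

/-- Parabolic scaling and translation invariance of the free flow. -/
theorem propagator_dilate (t : ℝ) {h : ℝ} (hh : 0 < h) (x₀ : Space d) (f : L2 d) :
    propagator t (dilate h hh x₀ f) = dilate h hh x₀ (propagator (t / h ^ 2) f) := by
  refine fourier_injective ?_
  rw [fourier_propagator, fourier_dilate, fourier_dilate, fourier_propagator]
  refine Lp.ext ?_
  filter_upwards [phaseMul_ae (continuous_freePhase t)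
      (phaseMul _ (continuous_fourierTranslationPhase x₀) (dilate h⁻¹ (inv_pos.2 hh) 0 (𝓕 f))),
    phaseMul_ae (continuous_fourierTranslationPhase x₀) (dilate h⁻¹ (inv_pos.2 hh) 0 (𝓕 f)),
    dilate_ae (inv_pos.2 hh) 0 (𝓕 f),
    phaseMul_ae (continuous_fourierTranslationPhase x₀) (dilate h⁻¹ (inv_pos.2 hh) 0
      (phaseMul _ (continuous_freePhase (t / h ^ 2)) (𝓕 f))),
    dilate_ae (inv_pos.2 hh) 0 (phaseMul _ (continuous_freePhase (t / h ^ 2)) (𝓕 f)),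
    (quasiMeasurePreserving_affine (inv_pos.2 hh) (0 : Space d)).ae
      (phaseMul_ae (continuous_freePhase (t / h ^ 2)) (𝓕 f))] with η e1 e2 e3 e4 e5 e6
  rw [e1, e2, e3, e4, e5, e6]
  have : -(t / h ^ 2) * ‖(2 * Real.pi) • (h⁻¹)⁻¹ • (η - 0)‖ ^ 2
      = -t * ‖(2 * Real.pi) • η‖ ^ 2 := by
    rw [inv_inv, sub_zero, smul_comm, norm_smul h, Real.norm_of_nonneg hh.le, mul_pow]
    field_simp
  rw [this]
  ring

/-- Galilean invariance: `e^{itΔ} M_ξ f = e^{-it|ξ|²} M_ξ τ_{2tξ} e^{itΔ} f`. -/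
theorem propagator_modulate (t θ : ℝ) (ξ : Space d) (f : L2 d) :
    propagator t (phaseMul _ (continuous_modPhase θ ξ) f) =
      phaseMul _ (continuous_modPhase (θ - t * ‖ξ‖ ^ 2) ξ)
        (dilate 1 one_pos ((2 * t) • ξ) (propagator t f)) := by
  refine fourier_injective ?_
  rw [fourier_propagator, fourier_modulate, fourier_modulate, fourier_dilate, fourier_propagator]
  refine Lp.ext ?_
  set v : Space d := (2 * Real.pi)⁻¹ • ξ
  set g : L2 d := 𝓕 f
  have q1 := quasiMeasurePreserving_affine one_pos v
  have q2 := quasiMeasurePreserving_affine (inv_pos.2 one_pos) (0 : Space d)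
  filter_upwards [phaseMul_ae (continuous_freePhase t)
      (phaseMul (fun _ => θ) continuous_const (dilate 1 one_pos v g)),
    phaseMul_ae (a := fun _ => θ) continuous_const (dilate 1 one_pos v g),
    dilate_ae one_pos v g,
    phaseMul_ae (a := fun _ => θ - t * ‖ξ‖ ^ 2) continuous_const (dilate 1 one_pos v
      (phaseMul _ (continuous_fourierTranslationPhase ((2 * t) • ξ))
        (dilate 1⁻¹ (inv_pos.2 one_pos) 0 (phaseMul _ (continuous_freePhase t) g)))),
    dilate_ae one_pos v
      (phaseMul _ (continuous_fourierTranslationPhase ((2 * t) • ξ))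
        (dilate 1⁻¹ (inv_pos.2 one_pos) 0 (phaseMul _ (continuous_freePhase t) g))),
    q1.ae (phaseMul_ae (continuous_fourierTranslationPhase ((2 * t) • ξ))
        (dilate 1⁻¹ (inv_pos.2 one_pos) 0 (phaseMul _ (continuous_freePhase t) g))),
    q1.ae (dilate_ae (inv_pos.2 one_pos) 0 (phaseMul _ (continuous_freePhase t) g)),
    q1.ae (q2.ae (phaseMul_ae (continuous_freePhase t) g))] with η e1 e2 e3 e4 e5 e6 e7 e8
  rw [e1, e2, e3, e4, e5, e6, e7, e8]
  have hw : (1 : ℝ)⁻¹⁻¹ • ((1 : ℝ)⁻¹ • (η - v) - 0) = (1 : ℝ)⁻¹ • (η - v) := by simp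
  rw [hw]
  have hc : ((1 / (1 : ℝ)⁻¹ ^ ((d : ℝ) / 2) : ℝ) : ℂ) = 1 := by simp
  have hc' : ((1 / (1 : ℝ) ^ ((d : ℝ) / 2) : ℝ) : ℂ) = 1 := by simp
  rw [hc, hc', one_mul, one_mul, one_mul, ← mul_assoc, ← mul_assoc, ← mul_assoc,
    ← Complex.exp_add, ← Complex.exp_add, ← Complex.exp_add]
  congr 2
  rw [← mul_add, ← mul_add, ← mul_add]
  congr 1
  norm_cast
  -- expand `|2πη|²` around the shifted frequency `η - ξ/2π`
  have hη : (2 * Real.pi) • η = (2 * Real.pi) • (η - v) + ξ := by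
    have : (2 * Real.pi) • v = ξ := smul_inv_smul₀ (by positivity) _
    rw [smul_sub, this, sub_add_cancel]
  rw [hη, norm_add_sq_real, inv_one, one_smul, real_inner_smul_left, real_inner_smul_right]
  ring

theorem propagator_add (s t : ℝ) (f : L2 d) :
    propagator s (propagator t f) = propagator (s + t) f := by
  refine fourier_injective ?_
  rw [fourier_propagator, fourier_propagator, fourier_propagator]
  refine Lp.ext ?_
  filter_upwards [phaseMul_ae (continuous_freePhase s)
    (phaseMul _ (continuous_freePhase t) (𝓕 f)), phaseMul_ae (continuous_freePhase t) (𝓕 f),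
    phaseMul_ae (continuous_freePhase (s + t)) (𝓕 f)] with η e1 e2 e3
  rw [e1, e2, e3, ← mul_assoc, ← Complex.exp_add]
  congr 2
  push_cast
  ring

/-- The space-time action of the symmetries: up to a phase, `e^{itΔ} g φ` is the evolution of `φ`
transported by the parabolic rescaling, the translations and the Galilean boost. -/
theorem norm_propagator_symm_ae (θ : ℝ) (p : Param d) (φ : L2 d) (t : ℝ) :
    ∀ᵐ x, ‖propagator t (symm θ p φ) x‖ = 1 / p.h ^ ((d : ℝ) / 2) *
      ‖propagator ((t - p.t) / p.h ^ 2) φ (p.h⁻¹ • (x - (p.x + (2 * t) • p.ξ)))‖ := by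
  have e : propagator t (symm θ p φ) = phaseMul _ (continuous_modPhase (θ - t * ‖p.ξ‖ ^ 2) p.ξ)
        (dilate 1 one_pos ((2 * t) • p.ξ)
          (dilate p.h p.h_pos p.x (propagator ((t - p.t) / p.h ^ 2) φ))) := by
    rw [symm, propagator_modulate, propagator_add, propagator_dilate, ← sub_eq_add_neg]
  rw [e]
  filter_upwards [phaseMul_ae (continuous_modPhase (θ - t * ‖p.ξ‖ ^ 2) p.ξ)
        (dilate 1 one_pos ((2 * t) • p.ξ)
          (dilate p.h p.h_pos p.x (propagator ((t - p.t) / p.h ^ 2) φ))),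
    dilate_ae one_pos ((2 * t) • p.ξ) (dilate p.h p.h_pos p.x (propagator ((t - p.t) / p.h ^ 2) φ)),
    (quasiMeasurePreserving_affine one_pos ((2 * t) • p.ξ)).ae
      (dilate_ae p.h_pos p.x (propagator ((t - p.t) / p.h ^ 2) φ))] with x e1 e2 e3
  have hx : (1 : ℝ)⁻¹ • (x - (2 * t) • p.ξ) - p.x = x - (p.x + (2 * t) • p.ξ) := by
    rw [inv_one, one_smul]
    abel
  rw [e1, e2, e3, hx, norm_mul, mul_comm Complex.I, Complex.norm_exp_ofReal_mul_I, one_mul,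
    norm_mul, norm_mul, Complex.norm_real, Complex.norm_real,
    Real.norm_of_nonneg (one_div_nonneg.2 (Real.rpow_nonneg p.h_pos.le _))]
  simp

/-! ### Jointly measurable representatives of the evolution -/

/-- Dominated convergence to zero in `L^p`, `0 < p < ∞`, for `[0, ∞]`-valued functions. -/
theorem tendsto_eLpNorm_zero_of_dominated {α : Type*} [MeasurableSpace α] {μ : Measure α}
    {p : ℝ≥0∞} (hp0 : p ≠ 0) (hp : p ≠ ∞) {f : ℕ → α → ℝ≥0∞} {g : α → ℝ≥0∞}
    (hf : ∀ n, AEMeasurable (f n) μ) (hfg : ∀ n, ∀ᵐ x ∂μ, f n x ≤ g x) (hg : eLpNorm g p μ ≠ ∞)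
    (hlim : ∀ᵐ x ∂μ, Tendsto (fun n => f n x) atTop (𝓝 0)) :
    Tendsto (fun n => eLpNorm (f n) p μ) atTop (𝓝 0) := by
  have hp' : 0 < p.toReal := ENNReal.toReal_pos hp0 hp
  have key : Tendsto (fun n => ∫⁻ x, f n x ^ p.toReal ∂μ) atTop (𝓝 (∫⁻ _, 0 ∂μ)) := by
    refine tendsto_lintegral_of_dominated_convergence' (fun x => g x ^ p.toReal)
      (fun n => (hf n).pow_const _) (fun n => ?_) ?_ ?_
    · filter_upwards [hfg n] with x hx
      exact ENNReal.rpow_le_rpow hx hp'.le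
    · intro h
      apply hg
      rw [eLpNorm_eq_lintegral_rpow_enorm_toReal hp0 hp]
      simp only [enorm_eq_self]
      rw [h, ENNReal.top_rpow_of_pos (by positivity)]
    · filter_upwards [hlim] with x hx
      have := (ENNReal.continuous_rpow_const (y := p.toReal)).tendsto 0 |>.comp hx
      rwa [ENNReal.zero_rpow_of_pos hp'] at this
  rw [lintegral_zero] at key
  have h2 := (ENNReal.continuous_rpow_const (y := 1 / p.toReal)).tendsto 0 |>.comp key
  rw [ENNReal.zero_rpow_of_pos (by positivity)] at h2
  refine h2.congr fun n => ?_
  rw [eLpNorm_eq_lintegral_rpow_enorm_toReal hp0 hp]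
  simp

theorem continuous_propagator (φ : L2 d) : Continuous fun t : ℝ => propagator t φ := by
  have h1 : Continuous fun t : ℝ => phaseMul _ (continuous_freePhase (d := d) t) (𝓕 φ) := by
    set g : L2 d := 𝓕 φ
    refine continuous_iff_seqContinuous.2 fun s t hs => ?_
    rw [Function.comp_def, Lp.tendsto_Lp_iff_tendsto_eLpNorm']
    have h2 : ∀ n, eLpNorm (⇑(phaseMul _ (continuous_freePhase (d := d) (s n)) g) -
        ⇑(phaseMul _ (continuous_freePhase (d := d) t) g)) 2 volume =
        eLpNorm (fun η : Space d => ‖(Complex.exp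
          (Complex.I * ((-s n * ‖(2 * Real.pi) • η‖ ^ 2 : ℝ) : ℂ))
          - Complex.exp (Complex.I * ((-t * ‖(2 * Real.pi) • η‖ ^ 2 : ℝ) : ℂ))) * g η‖ₑ)
          2 volume := by
      intro n
      rw [eLpNorm_enorm]
      refine eLpNorm_congr_ae ?_
      filter_upwards [phaseMul_ae (continuous_freePhase (s n)) g,
        phaseMul_ae (continuous_freePhase t) g] with η e1 e2
      rw [Pi.sub_apply, e1, e2, sub_mul]
    simp only [h2]
    refine tendsto_eLpNorm_zero_of_dominated (g := fun η => ‖2 * g η‖ₑ) (by norm_num) (by norm_num)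
      (fun n => ?_) (fun n => ae_of_all _ fun η => ?_) ?_ (ae_of_all _ fun η => ?_)
    · refine (AEStronglyMeasurable.mul ?_ (Lp.aestronglyMeasurable g)).enorm
      exact Continuous.aestronglyMeasurable (by fun_prop)
    · rw [enorm_mul, enorm_mul]
      gcongr
      rw [← ofReal_norm, ← ofReal_norm]
      refine ENNReal.ofReal_le_ofReal ((norm_sub_le _ _).trans ?_)
      rw [mul_comm Complex.I, Complex.norm_exp_ofReal_mul_I, mul_comm Complex.I,
        Complex.norm_exp_ofReal_mul_I]
      norm_num
    · rw [eLpNorm_enorm]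
      exact ((Lp.memLp g).const_mul 2).2.ne
    · have hc : Continuous fun r : ℝ => ‖(Complex.exp
          (Complex.I * ((-r * ‖(2 * Real.pi) • η‖ ^ 2 : ℝ) : ℂ))
          - Complex.exp (Complex.I * ((-t * ‖(2 * Real.pi) • η‖ ^ 2 : ℝ) : ℂ))) * g η‖ₑ := by
        fun_prop
      have := (hc.tendsto t).comp hs
      simpa [Function.comp_def] using this
  exact (Lp.fourierTransformₗᵢ (Space d) ℂ).symm.continuous.comp h1

/-- A continuous curve in `L²` has a jointly measurable representative. -/
theorem exists_measurable_representative {u : ℝ → L2 d} (hu : Continuous u) :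
    ∃ U : ℝ → Space d → ℂ, Measurable (Function.uncurry U) ∧ ∀ t, U t =ᵐ[volume] u t := by
  have : Fact ((2 : ℝ≥0∞) ≠ ∞) := ⟨by norm_num⟩
  -- approximate `u t` by members of a countable dense set, fast enough for a.e. convergence
  obtain ⟨e, hd0⟩ : ∃ e : ℕ → L2 d, DenseRange e :=
    ⟨_, TopologicalSpace.denseRange_denseSeq (L2 d)⟩
  have hex : ∀ (n : ℕ) (t : ℝ), ∃ i, edist (u t) (e i) < (2⁻¹ : ℝ≥0∞) ^ (n + 1) := by
    intro n t
    obtain ⟨i, hi⟩ := hd0.exists_mem_open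
      (Metric.isOpen_eball (x := u t) (ε := (2⁻¹ : ℝ≥0∞) ^ (n + 1)))
      ⟨u t, Metric.mem_eball_self (ENNReal.pow_pos (by simp) _)⟩
    exact ⟨i, by simpa [edist_comm] using hi⟩
  obtain ⟨N, hN, hNs⟩ : ∃ N : ℕ → ℝ → ℕ, (∀ n, Measurable (N n)) ∧
      ∀ n t, edist (u t) (e (N n t)) < (2⁻¹ : ℝ≥0∞) ^ (n + 1) := by
    classical
    exact ⟨fun n t => Nat.find (hex n t), fun n => measurable_find (hex n) fun i =>
      measurableSet_lt (hu.edist continuous_const).measurable measurable_const,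
      fun n t => Nat.find_spec (hex n t)⟩
  let f : ℕ → ℝ × Space d → ℂ := fun n p => e (N n p.1) p.2
  have hf : ∀ n, Measurable (f n) := by
    intro n
    have h1 : Measurable fun p : ℕ × Space d => e p.1 p.2 :=
      measurable_from_prod_countable_right fun i => (Lp.stronglyMeasurable (e i)).measurable
    exact h1.comp (((hN n).comp measurable_fst).prodMk measurable_snd)
  have hlim : Measurable fun p => limUnder atTop fun n => f n p :=
    (StronglyMeasurable.limUnder fun n => (hf n).stronglyMeasurable).measurable
  refine ⟨fun t x => limUnder atTop fun n => f n (t, x), hlim, fun t => ?_⟩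
  have hL : Tendsto (fun n => e (N n t)) atTop (𝓝 (u t)) := by
    rw [tendsto_iff_edist_tendsto_0]
    refine tendsto_of_tendsto_of_tendsto_of_le_of_le tendsto_const_nhds
      ((ENNReal.tendsto_pow_atTop_nhds_zero_of_lt_one (r := 2⁻¹) (by simp)).comp
        (tendsto_add_atTop_nat 1)) (fun _ => zero_le) fun n => ?_
    rw [edist_comm]
    exact (hNs n t).le
  obtain ⟨ns, hns, hae⟩ := ((tendstoInMeasure_of_tendsto_Lp hL).exists_seq_tendsto_ae)
  have hcau : ∀ᵐ x, ∃ l : ℂ, Tendsto (fun n => e (N n t) x) atTop (𝓝 l) := by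
    refine Lp.ae_tendsto_of_cauchy_eLpNorm (p := 2) (B := fun n => 2⁻¹ ^ n)
      (fun n => Lp.aestronglyMeasurable _) (by norm_num) ?_ ?_
    · rw [ENNReal.tsum_geometric]
      simp
    · intro M n m hn hm
      rw [← Lp.edist_def]
      refine (edist_triangle_left _ _ (u t)).trans_lt ?_
      have h2 : ∀ k, M ≤ k → edist (u t) (e (N k t)) < (2⁻¹ : ℝ≥0∞) ^ (M + 1) := fun k hk =>
        (hNs k t).trans_le (pow_le_pow_right_of_le_one' (by simp) (by omega))
      refine (ENNReal.add_lt_add (h2 n hn) (h2 m hm)).trans_le ?_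
      rw [pow_succ, ← mul_add, ENNReal.inv_two_add_inv_two, mul_one]
  filter_upwards [hae, hcau] with x h1 ⟨l, hl⟩
  have := tendsto_nhds_unique (hl.comp hns.tendsto_atTop) h1
  rw [← this]
  exact hl.limUnder_eq

/-! ### Mixed norms of moduli, their transport and truncation -/

/-- The mixed norm `L^q_t L^r_x` of a `[0, ∞]`-valued function on space-time. -/
def mixed (q r : ℝ≥0∞) (F : ℝ → Space d → ℝ≥0∞) : ℝ≥0∞ :=
  eLpNorm (fun t => eLpNorm (F t) r volume) q volume

theorem measurable_slice {F : ℝ → Space d → ℝ≥0∞} (hF : Measurable (Function.uncurry F)) (t : ℝ) :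
    Measurable (F t) :=
  hF.comp measurable_prodMk_left

theorem measurable_eLpNorm_slice {r : ℝ≥0∞} (hr0 : r ≠ 0) (hr : r ≠ ∞) {F : ℝ → Space d → ℝ≥0∞}
    (hF : Measurable (Function.uncurry F)) : Measurable fun t => eLpNorm (F t) r volume := by
  simp only [eLpNorm_eq_lintegral_rpow_enorm_toReal hr0 hr, enorm_eq_self]
  exact (hF.pow_const _).lintegral_prod_right'.pow_const _

theorem mixed_mono {q r : ℝ≥0∞} {F G : ℝ → Space d → ℝ≥0∞} (h : ∀ t, ∀ᵐ x, F t x ≤ G t x) :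
    mixed q r F ≤ mixed q r G := by
  refine eLpNorm_mono_enorm fun t => ?_
  simp only [enorm_eq_self]
  refine eLpNorm_mono_enorm_ae ?_
  simpa using h t

theorem mixed_add_le {q r : ℝ≥0∞} (hq : 1 ≤ q) (hr1 : 1 ≤ r) (hr : r ≠ ∞)
    {F G : ℝ → Space d → ℝ≥0∞}
    (hF : Measurable (Function.uncurry F)) (hG : Measurable (Function.uncurry G)) :
    mixed q r (fun t x => F t x + G t x) ≤ mixed q r F + mixed q r G := by
  have hr0 : r ≠ 0 := (one_pos.trans_le hr1).ne'
  refine le_trans (eLpNorm_mono_enorm (g := (fun t => eLpNorm (F t) r volume) +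
    fun t => eLpNorm (G t) r volume) fun t => ?_) (eLpNorm_add_le
      (measurable_eLpNorm_slice hr0 hr hF).aestronglyMeasurable
      (measurable_eLpNorm_slice hr0 hr hG).aestronglyMeasurable hq)
  simp only [enorm_eq_self, Pi.add_apply]
  exact eLpNorm_add_le (measurable_slice hF _).aestronglyMeasurable
    (measurable_slice hG _).aestronglyMeasurable hr1

theorem mixed_zero {q r : ℝ≥0∞} : mixed q r (fun (_ : ℝ) (_ : Space d) => 0) = 0 := by
  have : (fun _ : Space d => (0 : ℝ≥0∞)) = 0 := rfl
  simp only [mixed, this, eLpNorm_zero]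
  exact eLpNorm_zero

theorem measurable_uncurry_sum {ι : Type*} (s : Finset ι) {F : ι → ℝ → Space d → ℝ≥0∞}
    (hF : ∀ i, Measurable (Function.uncurry (F i))) :
    Measurable (Function.uncurry fun t x => ∑ i ∈ s, F i t x) :=
  Finset.measurable_sum s fun i _ => hF i

theorem mixed_sum_le {q r : ℝ≥0∞} (hq : 1 ≤ q) (hr1 : 1 ≤ r) (hr : r ≠ ∞) {ι : Type*}
    (s : Finset ι) {F : ι → ℝ → Space d → ℝ≥0∞}
    (hF : ∀ i, Measurable (Function.uncurry (F i))) :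
    mixed q r (fun t x => ∑ i ∈ s, F i t x) ≤ ∑ i ∈ s, mixed q r (F i) := by
  classical
  induction s using Finset.induction_on with
  | empty => simp [mixed_zero]
  | insert a s ha ih =>
    simp only [Finset.sum_insert ha]
    exact (mixed_add_le hq hr1 hr (hF a) (measurable_uncurry_sum s hF)).trans (by gcongr)

theorem mixed_eq_lintegral {q r : ℝ≥0∞} (hq0 : q ≠ 0) (hq : q ≠ ∞) (hr0 : r ≠ 0) (hr : r ≠ ∞)
    (F : ℝ → Space d → ℝ≥0∞) :
    mixed q r F =
      (∫⁻ t, (∫⁻ x, F t x ^ r.toReal) ^ (q.toReal / r.toReal)) ^ (1 / q.toReal) := by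
  simp only [mixed, eLpNorm_eq_lintegral_rpow_enorm_toReal hr0 hr,
    eLpNorm_eq_lintegral_rpow_enorm_toReal hq0 hq, enorm_eq_self]
  congr 2
  ext t
  rw [← ENNReal.rpow_mul]
  congr 1
  ring

/-- Subadditivity of the mixed norm to the power `min q r` on pairs of functions with disjoint
supports: for `r ≤ q` this is Minkowski's inequality in `L^{q/r}`, for `q ≤ r` it is
subadditivity of `s ↦ s^{q/r}`. -/
theorem mixed_add_rpow_le {q r : ℝ≥0∞} (hq0 : q ≠ 0) (hq : q ≠ ∞) (hr0 : r ≠ 0) (hr : r ≠ ∞)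
    {F G : ℝ → Space d → ℝ≥0∞}
    (hF : Measurable (Function.uncurry F)) (hG : Measurable (Function.uncurry G))
    (hFG : ∀ t x, F t x = 0 ∨ G t x = 0) :
    mixed q r (fun t x => F t x + G t x) ^ (min q r).toReal
      ≤ mixed q r F ^ (min q r).toReal + mixed q r G ^ (min q r).toReal := by
  have hq' : 0 < q.toReal := ENNReal.toReal_pos hq0 hq
  have hr' : 0 < r.toReal := ENNReal.toReal_pos hr0 hr
  have hadd : ∀ t, ∫⁻ x, (F t x + G t x) ^ r.toReal
      = (∫⁻ x, F t x ^ r.toReal) + ∫⁻ x, G t x ^ r.toReal := by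
    intro t
    rw [← lintegral_add_left ((measurable_slice hF t).pow_const _)]
    congr 1
    ext x
    rcases hFG t x with h | h <;> simp [h, ENNReal.zero_rpow_of_pos hr']
  have mF : Measurable fun t => ∫⁻ x, F t x ^ r.toReal :=
    (hF.pow_const _).lintegral_prod_right'
  have mG : Measurable fun t => ∫⁻ x, G t x ^ r.toReal :=
    (hG.pow_const _).lintegral_prod_right'
  simp only [mixed_eq_lintegral hq0 hq hr0 hr, hadd, ← ENNReal.rpow_mul]
  rcases le_total q r with hqr | hqr
  · rw [min_eq_left hqr, one_div_mul_cancel hq'.ne']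
    simp only [ENNReal.rpow_one]
    rw [← lintegral_add_left (mF.pow_const _)]
    refine lintegral_mono fun t => ENNReal.rpow_add_le_add_rpow _ _ (by positivity) ?_
    rw [div_le_one hr']
    exact ENNReal.toReal_mono hr hqr
  · rw [min_eq_right hqr]
    have e : 1 / q.toReal * r.toReal = 1 / (q.toReal / r.toReal) := by field_simp
    rw [e]
    exact ENNReal.lintegral_Lp_add_le mF.aemeasurable mG.aemeasurable
      ((one_le_div hr').2 (ENNReal.toReal_mono hq hqr))

theorem mixed_sum_rpow_le {q r : ℝ≥0∞} (hq0 : q ≠ 0) (hq : q ≠ ∞) (hr0 : r ≠ 0) (hr : r ≠ ∞)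
    {ι : Type*} (s : Finset ι) {F : ι → ℝ → Space d → ℝ≥0∞}
    (hF : ∀ i, Measurable (Function.uncurry (F i)))
    (hdisj : ∀ i j, i ≠ j → ∀ t x, F i t x = 0 ∨ F j t x = 0) :
    mixed q r (fun t x => ∑ i ∈ s, F i t x) ^ (min q r).toReal
      ≤ ∑ i ∈ s, mixed q r (F i) ^ (min q r).toReal := by
  classical
  have hm : 0 < (min q r).toReal :=
    ENNReal.toReal_pos (by simp [min_eq_iff, hq0, hr0]) (by simp [hq])
  induction s using Finset.induction_on with
  | empty => simp [mixed_zero, ENNReal.zero_rpow_of_pos hm]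
  | insert a s ha ih =>
    simp only [Finset.sum_insert ha]
    refine (mixed_add_rpow_le hq0 hq hr0 hr (hF a) (measurable_uncurry_sum s hF) ?_).trans
      (by gcongr)
    intro t x
    by_cases h : F a t x = 0
    · exact Or.inl h
    · refine Or.inr (Finset.sum_eq_zero fun i hi => ?_)
      exact (hdisj a i (fun e => ha (e ▸ hi)) t x).resolve_left h

theorem eLpNorm_const_mul_ennreal {α : Type*} [MeasurableSpace α] {μ : Measure α} {p c : ℝ≥0∞}
    (hp0 : p ≠ 0) (hp : p ≠ ∞) (hc : c ≠ ∞) (f : α → ℝ≥0∞) :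
    eLpNorm (fun x => c * f x) p μ = c * eLpNorm f p μ := by
  have hp' : 0 < p.toReal := ENNReal.toReal_pos hp0 hp
  simp only [eLpNorm_eq_lintegral_rpow_enorm_toReal hp0 hp, enorm_eq_self,
    ENNReal.mul_rpow_of_nonneg _ _ hp'.le]
  rw [lintegral_const_mul' _ _ (ENNReal.rpow_ne_top_of_nonneg hp'.le hc),
    ENNReal.mul_rpow_of_nonneg _ _ (by positivity), ← ENNReal.rpow_mul,
    mul_one_div_cancel hp'.ne', ENNReal.rpow_one]

/-- The action of a parameter `p = (h, ξ, x₀, t₀)` on moduli of space-time functions: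
`h^{-d/2} F((t - t₀)/h², (x - x₀ - 2tξ)/h)`. -/
def transport (p : Param d) (F : ℝ → Space d → ℝ≥0∞) (t : ℝ) (x : Space d) : ℝ≥0∞ :=
  ENNReal.ofReal (1 / p.h ^ ((d : ℝ) / 2)) *
    F ((t - p.t) / p.h ^ 2) (p.h⁻¹ • (x - (p.x + (2 * t) • p.ξ)))

theorem measurable_transport (p : Param d) {F : ℝ → Space d → ℝ≥0∞}
    (hF : Measurable (Function.uncurry F)) : Measurable (Function.uncurry (transport p F)) := by
  have : Measurable fun z : ℝ × Space d =>
      ((z.1 - p.t) / p.h ^ 2, p.h⁻¹ • (z.2 - (p.x + (2 * z.1) • p.ξ))) := by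
    fun_prop
  exact (hF.comp this).const_mul _

theorem transport_add (p : Param d) (F G : ℝ → Space d → ℝ≥0∞) (t : ℝ) (x : Space d) :
    transport p (fun t x => F t x + G t x) t x = transport p F t x + transport p G t x :=
  mul_add _ _ _

theorem eLpNorm_transport (p : Param d) {r : ℝ≥0∞} (hr0 : r ≠ 0) (hr : r ≠ ∞)
    {F : ℝ → Space d → ℝ≥0∞} (hF : Measurable (Function.uncurry F)) (t : ℝ) :
    eLpNorm (transport p F t) r volume =
      ENNReal.ofReal (p.h ^ ((d : ℝ) / r.toReal - d / 2)) *
        eLpNorm (F ((p.h ^ 2)⁻¹ • (t - p.t))) r volume := by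
  have hh := p.h_pos
  have h1 := eLpNorm_comp_affine (volume : Measure (Space d)) hr hh (p.x + (2 * t) • p.ξ)
    (f := F ((p.h ^ 2)⁻¹ • (t - p.t))) (measurable_slice hF _).aestronglyMeasurable
  have h2 : transport p F t = fun x => ENNReal.ofReal (1 / p.h ^ ((d : ℝ) / 2)) *
      F ((p.h ^ 2)⁻¹ • (t - p.t)) (p.h⁻¹ • (x - (p.x + (2 * t) • p.ξ))) := by
    ext x
    rw [transport, smul_eq_mul, inv_mul_eq_div]
  rw [h2, eLpNorm_const_mul_ennreal hr0 hr ENNReal.ofReal_ne_top, h1, ← mul_assoc,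
    ← ENNReal.ofReal_mul (by positivity)]
  congr 2
  rw [Real.rpow_sub hh, finrank_euclideanSpace_fin]
  ring

/-- Transport multiplies a mixed norm by the power of `h` that vanishes for admissible exponents. -/
theorem mixed_transport (p : Param d) {q r : ℝ≥0∞} (hq0 : q ≠ 0) (hq : q ≠ ∞) (hr0 : r ≠ 0)
    (hr : r ≠ ∞) {F : ℝ → Space d → ℝ≥0∞} (hF : Measurable (Function.uncurry F)) :
    mixed q r (transport p F) =
      ENNReal.ofReal (p.h ^ (2 / q.toReal + (d : ℝ) / r.toReal - d / 2)) * mixed q r F := by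
  have hh := p.h_pos
  simp only [mixed, eLpNorm_transport p hr0 hr hF]
  rw [eLpNorm_const_mul_ennreal hq0 hq ENNReal.ofReal_ne_top,
    eLpNorm_comp_affine (volume : Measure ℝ) hq (pow_pos hh 2) p.t
      (f := fun t => eLpNorm (F t) r volume)
      (measurable_eLpNorm_slice hr0 hr hF).aestronglyMeasurable, ← mul_assoc,
    ← ENNReal.ofReal_mul (by positivity)]
  congr 2
  rw [Module.finrank_self, ← Real.rpow_natCast, ← Real.rpow_mul hh.le, ← Real.rpow_add hh]
  congr 1
  push_cast
  ring

/-- The region of space-time where truncation at height `R` keeps a function. -/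
def truncRegion (F : ℝ → Space d → ℝ≥0∞) (R : ℕ) : Set (ℝ × Space d) :=
  {z | |z.1| ≤ R ∧ ‖z.2‖ ≤ R ∧ F z.1 z.2 ≤ R}

open Classical in
/-- Truncation to a bounded function supported in `|t| ≤ R`, `‖x‖ ≤ R`. -/
def trunc (F : ℝ → Space d → ℝ≥0∞) (R : ℕ) (t : ℝ) (x : Space d) : ℝ≥0∞ :=
  if (t, x) ∈ truncRegion F R then F t x else 0

open Classical in
/-- What truncation removes. -/
def truncRest (F : ℝ → Space d → ℝ≥0∞) (R : ℕ) (t : ℝ) (x : Space d) : ℝ≥0∞ :=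
  if (t, x) ∈ truncRegion F R then 0 else F t x

theorem trunc_add_truncRest (F : ℝ → Space d → ℝ≥0∞) (R : ℕ) (t : ℝ) (x : Space d) :
    F t x = trunc F R t x + truncRest F R t x := by
  unfold trunc truncRest
  split_ifs <;> simp

theorem measurableSet_truncRegion {F : ℝ → Space d → ℝ≥0∞} (hF : Measurable (Function.uncurry F))
    (R : ℕ) : MeasurableSet (truncRegion F R) := by
  have h1 : MeasurableSet {z : ℝ × Space d | |z.1| ≤ R} :=
    measurableSet_le (by fun_prop) measurable_const
  have h2 : MeasurableSet {z : ℝ × Space d | ‖z.2‖ ≤ R} :=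
    measurableSet_le (by fun_prop) measurable_const
  have h3 : MeasurableSet {z : ℝ × Space d | F z.1 z.2 ≤ R} :=
    measurableSet_le hF measurable_const
  exact h1.inter (h2.inter h3)

theorem measurable_trunc {F : ℝ → Space d → ℝ≥0∞} (hF : Measurable (Function.uncurry F)) (R : ℕ) :
    Measurable (Function.uncurry (trunc F R)) := by
  classical
  exact Measurable.ite (measurableSet_truncRegion hF R) hF measurable_const

theorem measurable_truncRest {F : ℝ → Space d → ℝ≥0∞} (hF : Measurable (Function.uncurry F))
    (R : ℕ) : Measurable (Function.uncurry (truncRest F R)) := by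
  classical
  exact Measurable.ite (measurableSet_truncRegion hF R) measurable_const hF

theorem trunc_le (F : ℝ → Space d → ℝ≥0∞) (R : ℕ) (t : ℝ) (x : Space d) : trunc F R t x ≤ F t x :=
  le_self_add.trans (trunc_add_truncRest F R t x).ge

theorem truncRest_le (F : ℝ → Space d → ℝ≥0∞) (R : ℕ) (t : ℝ) (x : Space d) :
    truncRest F R t x ≤ F t x :=
  le_add_self.trans (trunc_add_truncRest F R t x).ge

/-- Truncations approximate in the mixed norm: dominated convergence in `x` for almost every `t`,
and then in `t`. -/
theorem tendsto_mixed_truncRest {q r : ℝ≥0∞} (hq0 : q ≠ 0) (hq : q ≠ ∞) (hr0 : r ≠ 0)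
    (hr : r ≠ ∞) {F : ℝ → Space d → ℝ≥0∞} (hF : Measurable (Function.uncurry F))
    (hfin : ∀ t x, F t x ≠ ∞) (hN : mixed q r F ≠ ∞) :
    Tendsto (fun R => mixed q r (truncRest F R)) atTop (𝓝 0) := by
  refine tendsto_eLpNorm_zero_of_dominated hq0 hq
    (fun R => (measurable_eLpNorm_slice hr0 hr (measurable_truncRest hF R)).aemeasurable)
    (fun R => ae_of_all _ fun t => eLpNorm_mono_enorm fun x => ?_) hN ?_
  · simpa using truncRest_le F R t x
  · have hq' : 0 < q.toReal := ENNReal.toReal_pos hq0 hq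
    have hslice : ∀ᵐ t, eLpNorm (F t) r volume ≠ ∞ := by
      have h1 : ∫⁻ t, eLpNorm (F t) r volume ^ q.toReal ≠ ∞ := by
        have := lintegral_rpow_enorm_lt_top_of_eLpNorm_lt_top hq0 hq
          (lt_top_iff_ne_top.2 hN)
        simpa using this.ne
      have h2 := ae_lt_top ((measurable_eLpNorm_slice hr0 hr hF).pow_const _) h1
      filter_upwards [h2] with t ht h
      rw [h, ENNReal.top_rpow_of_pos hq'] at ht
      exact lt_irrefl _ ht
    filter_upwards [hslice] with t ht
    refine tendsto_eLpNorm_zero_of_dominated hr0 hr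
      (fun R => ((measurable_truncRest hF R).comp measurable_prodMk_left).aemeasurable)
      (fun R => ae_of_all _ fun x => truncRest_le F R t x) ht (ae_of_all _ fun x => ?_)
    refine tendsto_const_nhds.congr' ?_
    obtain ⟨R₁, h1⟩ := exists_nat_ge |t|
    obtain ⟨R₂, h2⟩ := exists_nat_ge ‖x‖
    obtain ⟨R₃, h3⟩ := ENNReal.exists_nat_gt (hfin t x)
    filter_upwards [eventually_ge_atTop (max R₁ (max R₂ R₃))] with R hR
    have hR1 : R₁ ≤ R := (le_max_left _ _).trans hR
    have hR2 : R₂ ≤ R := ((le_max_left _ _).trans (le_max_right _ _)).trans hR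
    have hR3 : R₃ ≤ R := ((le_max_right _ _).trans (le_max_right _ _)).trans hR
    have : (t, x) ∈ truncRegion F R := by
      refine ⟨h1.trans (by exact_mod_cast hR1), h2.trans (by exact_mod_cast hR2), h3.le.trans ?_⟩
      exact_mod_cast hR3
    rw [truncRest, if_pos this]

/-! ### Overlap of truncated profiles -/

/-- The space-time tube `|t - t₀| ≤ R h²`, `‖x - x₀ - 2tξ‖ ≤ R h` around the classical trajectory of
a parameter: the support of a transported function that lives in `|t| ≤ R`, `‖x‖ ≤ R`. -/
def tube (R : ℝ) (p : Param d) : Set (ℝ × Space d) :=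
  {z | |z.1 - p.t| ≤ R * p.h ^ 2 ∧ ‖z.2 - (p.x + (2 * z.1) • p.ξ)‖ ≤ R * p.h}

theorem measurableSet_tube (R : ℝ) (p : Param d) : MeasurableSet (tube R p) := by
  have h1 : MeasurableSet {z : ℝ × Space d | |z.1 - p.t| ≤ R * p.h ^ 2} :=
    measurableSet_le (by fun_prop) measurable_const
  have h2 : MeasurableSet {z : ℝ × Space d | ‖z.2 - (p.x + (2 * z.1) • p.ξ)‖ ≤ R * p.h} :=
    measurableSet_le (by fun_prop) measurable_const
  exact h1.inter h2

/-- The restriction of a space-time function to a set. -/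
def cut (A : Set (ℝ × Space d)) (F : ℝ → Space d → ℝ≥0∞) (t : ℝ) (x : Space d) : ℝ≥0∞ :=
  A.indicator (Function.uncurry F) (t, x)

theorem measurable_cut {A : Set (ℝ × Space d)} (hA : MeasurableSet A) {F : ℝ → Space d → ℝ≥0∞}
    (hF : Measurable (Function.uncurry F)) : Measurable (Function.uncurry (cut A F)) :=
  hF.indicator hA

theorem transport_trunc_eq_zero (p : Param d) (F : ℝ → Space d → ℝ≥0∞) (R : ℕ) {t : ℝ}
    {x : Space d} (h : (t, x) ∉ tube R p) : transport p (trunc F R) t x = 0 := by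
  have hh := p.h_pos
  unfold transport trunc
  rw [if_neg, mul_zero]
  rintro ⟨h1, h2, -⟩
  refine h ⟨?_, ?_⟩
  · rwa [abs_div, abs_of_pos (pow_pos hh 2), div_le_iff₀ (pow_pos hh 2)] at h1
  · rwa [norm_smul, norm_inv, Real.norm_of_nonneg hh.le, inv_mul_le_iff₀ hh, mul_comm p.h] at h2

theorem transport_trunc_le (p : Param d) (F : ℝ → Space d → ℝ≥0∞) (R : ℕ) (t : ℝ) (x : Space d) :
    transport p (trunc F R) t x ≤ ENNReal.ofReal (R / p.h ^ ((d : ℝ) / 2)) := by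
  have hh := p.h_pos
  have h1 : trunc F R ((t - p.t) / p.h ^ 2) (p.h⁻¹ • (x - (p.x + (2 * t) • p.ξ))) ≤ R := by
    unfold trunc
    split_ifs with h
    · exact h.2.2
    · exact zero_le
  calc _ ≤ ENNReal.ofReal (1 / p.h ^ ((d : ℝ) / 2)) * R := by
        unfold transport
        gcongr
    _ = _ := by
        rw [← ENNReal.ofReal_natCast, ← ENNReal.ofReal_mul (by positivity), one_div_mul_eq_div]

/-- The times at which the tubes of two parameters can meet. -/
def overlapTimes (R : ℝ) (p p' : Param d) : Set ℝ :=
  {t | |t - p.t| ≤ R * p.h ^ 2 ∧ |t - p'.t| ≤ R * p'.h ^ 2 ∧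
    ‖(p.x - p'.x) + (2 * t) • (p.ξ - p'.ξ)‖ ≤ R * (p.h + p'.h)}

theorem measurableSet_overlapTimes (R : ℝ) (p p' : Param d) :
    MeasurableSet (overlapTimes R p p') := by
  have h1 : MeasurableSet {t : ℝ | |t - p.t| ≤ R * p.h ^ 2} :=
    measurableSet_le (by fun_prop) measurable_const
  have h2 : MeasurableSet {t : ℝ | |t - p'.t| ≤ R * p'.h ^ 2} :=
    measurableSet_le (by fun_prop) measurable_const
  have h3 : MeasurableSet {t : ℝ | ‖(p.x - p'.x) + (2 * t) • (p.ξ - p'.ξ)‖ ≤ R * (p.h + p'.h)} :=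
    measurableSet_le (by fun_prop) measurable_const
  exact h1.inter (h2.inter h3)

theorem mem_overlapTimes {R : ℝ} {p p' : Param d} {t : ℝ} {x : Space d}
    (h : (t, x) ∈ tube R p ∩ tube R p') : t ∈ overlapTimes R p p' := by
  obtain ⟨⟨h1, h2⟩, h3, h4⟩ := h
  refine ⟨h1, h3, ?_⟩
  have : (p.x - p'.x) + (2 * t) • (p.ξ - p'.ξ)
      = (x - (p'.x + (2 * t) • p'.ξ)) - (x - (p.x + (2 * t) • p.ξ)) := by
    rw [smul_sub]
    abel
  rw [this]
  refine (norm_sub_le _ _).trans ?_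
  simp only at h2 h4
  linarith

theorem volume_overlapTimes_le_right {R : ℝ} (p p' : Param d) :
    volume (overlapTimes R p p') ≤ ENNReal.ofReal (R * (2 * p'.h ^ 2)) := by
  have : overlapTimes R p p' ⊆ Metric.closedBall p'.t (R * p'.h ^ 2) := fun t ht => ht.2.1
  refine (measure_mono this).trans ?_
  rw [Real.volume_closedBall]
  exact ENNReal.ofReal_le_ofReal (by linarith)

/-- If the velocities differ, the tubes separate after a time proportional to the inverse of the
relative velocity. -/
theorem volume_overlapTimes_le_of_pos {R : ℝ} (p p' : Param d) (hξ : 0 < ‖p.ξ - p'.ξ‖) :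
    volume (overlapTimes R p p') ≤ ENNReal.ofReal (R * (p.h + p'.h) / ‖p.ξ - p'.ξ‖) := by
  refine (Real.volume_le_diam _).trans (Metric.ediam_le fun s hs t ht => ?_)
  rw [edist_dist, Real.dist_eq]
  refine ENNReal.ofReal_le_ofReal ((le_div_iff₀ hξ).2 ?_)
  have h1 : (2 * (s - t)) • (p.ξ - p'.ξ) = ((p.x - p'.x) + (2 * s) • (p.ξ - p'.ξ)) -
      ((p.x - p'.x) + (2 * t) • (p.ξ - p'.ξ)) := by
    rw [mul_sub, sub_smul]
    abel
  have h2 := norm_sub_le ((p.x - p'.x) + (2 * s) • (p.ξ - p'.ξ))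
    ((p.x - p'.x) + (2 * t) • (p.ξ - p'.ξ))
  rw [← h1, norm_smul, Real.norm_eq_abs, abs_mul, abs_two] at h2
  linarith [hs.2.2, ht.2.2]

/-- The constant in the bounds for overlaps of truncated profiles. -/
def overlapConst (d : ℕ) (q r : ℝ≥0∞) (R : ℕ) : ℝ :=
  R * ((R : ℝ) ^ d * (volume (Metric.closedBall (0 : Space d) 1)).toReal) ^ (1 / r.toReal) *
    (R : ℝ) ^ (1 / q.toReal)

theorem overlapConst_nonneg (d : ℕ) (q r : ℝ≥0∞) (R : ℕ) : 0 ≤ overlapConst d q r R := by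
  unfold overlapConst
  positivity

theorem volume_closedBall_le (c : Space d) {s : ℝ} (hs : 0 ≤ s) :
    volume (Metric.closedBall c s) =
      ENNReal.ofReal (s ^ d * (volume (Metric.closedBall (0 : Space d) 1)).toReal) := by
  rw [Measure.addHaar_closedBall' _ _ hs, finrank_euclideanSpace_fin,
    ENNReal.ofReal_mul (by positivity), ENNReal.ofReal_toReal measure_closedBall_lt_top.ne]

/-- Size of a truncated transported profile on its intersection with another tube, in terms of the
scale `ρ` of either tube and of the duration `R κ ρ²` of the overlap. -/
theorem mixed_cut_le {q r : ℝ≥0∞} (hq0 : q ≠ 0) (hq : q ≠ ∞) (hr0 : r ≠ 0) (hr : r ≠ ∞)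
    (hadm : 2 / q.toReal + (d : ℝ) / r.toReal = d / 2) (F : ℝ → Space d → ℝ≥0∞) (R : ℕ)
    (p p' : Param d) {ρ κ : ℝ} (hρ : ρ = p.h ∨ ρ = p'.h) (hκ : 0 ≤ κ)
    (hτ : volume (overlapTimes R p p') ≤ ENNReal.ofReal (R * (κ * ρ ^ 2))) :
    mixed q r (cut (tube R p ∩ tube R p') (transport p (trunc F R))) ≤
      ENNReal.ofReal (overlapConst d q r R * (ρ / p.h) ^ ((d : ℝ) / 2) * κ ^ (1 / q.toReal)) := by
  have hh := p.h_pos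
  have hρ0 : 0 < ρ := by rcases hρ with h | h <;> rw [h]; exacts [p.h_pos, p'.h_pos]
  have hq' : 0 < q.toReal := ENNReal.toReal_pos hq0 hq
  have hr' : 0 < r.toReal := ENNReal.toReal_pos hr0 hr
  set ω := (volume (Metric.closedBall (0 : Space d) 1)).toReal with hω
  have hω0 : 0 ≤ ω := ENNReal.toReal_nonneg
  set M : ℝ := R / p.h ^ ((d : ℝ) / 2) with hM
  have hM0 : 0 ≤ M := by positivity
  set v : ℝ := (R * ρ) ^ d * ω with hv
  have hv0 : 0 ≤ v := by positivity
  -- each time slice of the overlap lies in a ball of radius `R ρ`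
  have hslice : ∀ t, eLpNorm (cut (tube R p ∩ tube R p') (transport p (trunc F R)) t) r volume ≤
      (overlapTimes R p p').indicator (fun _ => ENNReal.ofReal (M * v ^ (1 / r.toReal))) t := by
    intro t
    by_cases ht : t ∈ overlapTimes R p p'
    · rw [Set.indicator_of_mem ht]
      obtain ⟨c, hc⟩ : ∃ c : Space d, ∀ x, (t, x) ∈ tube R p ∩ tube R p' →
          x ∈ Metric.closedBall c (R * ρ) := by
        rcases hρ with h | h
        · exact ⟨p.x + (2 * t) • p.ξ, fun x hx => by
            rw [mem_closedBall_iff_norm, h]; exact hx.1.2⟩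
        · exact ⟨p'.x + (2 * t) • p'.ξ, fun x hx => by
            rw [mem_closedBall_iff_norm, h]; exact hx.2.2⟩
      calc _ ≤ eLpNorm ((Metric.closedBall c (R * ρ)).indicator fun _ => ENNReal.ofReal M) r
            volume := by
            refine eLpNorm_mono_enorm fun x => ?_
            simp only [enorm_eq_self, cut]
            by_cases hx : (t, x) ∈ tube R p ∩ tube R p'
            · rw [Set.indicator_of_mem hx, Set.indicator_of_mem (hc x hx)]
              exact transport_trunc_le p F R t x
            · rw [Set.indicator_of_notMem hx]
              exact zero_le
        _ = ENNReal.ofReal M * ENNReal.ofReal v ^ (1 / r.toReal) := by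
            rw [eLpNorm_indicator_const Metric.isClosed_closedBall.measurableSet hr0 hr,
              volume_closedBall_le _ (by positivity), enorm_eq_self]
        _ = _ := by
            rw [ENNReal.ofReal_rpow_of_nonneg hv0 (by positivity), ← ENNReal.ofReal_mul hM0]
    · rw [Set.indicator_of_notMem ht]
      have : cut (tube R p ∩ tube R p') (transport p (trunc F R)) t = 0 := by
        ext x
        exact Set.indicator_of_notMem (fun hx => ht (mem_overlapTimes hx)) _
      rw [this, eLpNorm_zero]
  calc _ ≤ eLpNorm ((overlapTimes R p p').indicator
        fun _ => ENNReal.ofReal (M * v ^ (1 / r.toReal))) q volume :=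
        eLpNorm_mono_enorm fun t => by simpa using hslice t
    _ ≤ ENNReal.ofReal (M * v ^ (1 / r.toReal)) *
        ENNReal.ofReal (R * (κ * ρ ^ 2)) ^ (1 / q.toReal) := by
        rw [eLpNorm_indicator_const (measurableSet_overlapTimes _ _ _) hq0 hq, enorm_eq_self]
        gcongr
    _ = _ := by
        rw [ENNReal.ofReal_rpow_of_nonneg (by positivity) (by positivity),
          ← ENNReal.ofReal_mul (by positivity)]
        congr 1
        have e1 : v ^ (1 / r.toReal)
            = ((R : ℝ) ^ d * ω) ^ (1 / r.toReal) * ρ ^ ((d : ℝ) / r.toReal) := by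
          rw [hv, mul_pow, mul_right_comm, Real.mul_rpow (by positivity) (by positivity),
            ← Real.rpow_natCast ρ, ← Real.rpow_mul hρ0.le, mul_one_div]
        have e2 : ((R : ℝ) * (κ * ρ ^ 2)) ^ (1 / q.toReal)
            = (R : ℝ) ^ (1 / q.toReal) * (κ ^ (1 / q.toReal) * ρ ^ (2 / q.toReal)) := by
          rw [Real.mul_rpow (by positivity) (by positivity),
            Real.mul_rpow (by positivity) (by positivity), ← Real.rpow_natCast ρ 2,
            ← Real.rpow_mul hρ0.le]
          push_cast
          rw [mul_one_div]
        have e3 : (ρ / p.h) ^ ((d : ℝ) / 2)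
            = ρ ^ (2 / q.toReal) * ρ ^ ((d : ℝ) / r.toReal) / p.h ^ ((d : ℝ) / 2) := by
          rw [Real.div_rpow hρ0.le hh.le, ← Real.rpow_add hρ0, hadm]
        rw [e1, e2, e3, overlapConst, hM]
        ring

/-- The separation of the scales and frequencies of two parameters, the first of the two quantities
whose divergence defines orthogonality. -/
def scaleGap (p p' : Param d) : ℝ := p'.h / p.h + p.h / p'.h + p.h * ‖p.ξ - p'.ξ‖

/-- The separation of the space-time centres of two parameters, the second of the two quantities
whose divergence defines orthogonality. -/
def centreGap (p p' : Param d) : ℝ :=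
  |p.t - p'.t| / p.h ^ 2 + ‖p.h⁻¹ • (p.x - p'.x) + (2 * p'.t / p.h) • (p.ξ - p'.ξ)‖

/-- Tubes of comparable scales and velocities that meet at some time have close centres: between the
times `t` and `p'.t` the trajectories separate by at most `2 |t - p'.t| ‖p.ξ - p'.ξ‖`. -/
theorem centreGap_le_of_mem_tube {R L K : ℝ} (hR : 0 ≤ R) {p p' : Param d}
    (hL : p'.h ≤ L * p.h) (hK : p.h * ‖p.ξ - p'.ξ‖ ≤ K) {t : ℝ} (ht : t ∈ overlapTimes R p p') :
    centreGap p p' ≤ R * (1 + L ^ 2) + (R * (1 + L) + 2 * R * L ^ 2 * K) := by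
  have hh := p.h_pos
  have hh' := p'.h_pos
  obtain ⟨h1, h2, h3⟩ := ht
  have hsq : p'.h ^ 2 ≤ L ^ 2 * p.h ^ 2 := by
    rw [← mul_pow]
    exact pow_le_pow_left₀ hh'.le hL 2
  have hRsq := mul_le_mul_of_nonneg_left hsq hR
  refine add_le_add ?_ ?_
  · rw [div_le_iff₀ (pow_pos hh 2)]
    have h4 := abs_sub_le p.t t p'.t
    rw [abs_sub_comm p.t t] at h4
    nlinarith
  · have e : p.h⁻¹ • (p.x - p'.x) + (2 * p'.t / p.h) • (p.ξ - p'.ξ)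
        = p.h⁻¹ • (((p.x - p'.x) + (2 * t) • (p.ξ - p'.ξ)) - (2 * (t - p'.t)) • (p.ξ - p'.ξ)) := by
      rw [add_sub_assoc, ← sub_smul, smul_add, smul_smul]
      congr 2
      ring
    rw [e, norm_smul, norm_inv, Real.norm_of_nonneg hh.le, inv_mul_le_iff₀ hh]
    refine (norm_sub_le _ _).trans ?_
    rw [norm_smul (2 * (t - p'.t)), Real.norm_eq_abs, abs_mul, abs_two]
    have h5 : |t - p'.t| * ‖p.ξ - p'.ξ‖ ≤ R * L ^ 2 * K * p.h := by
      calc |t - p'.t| * ‖p.ξ - p'.ξ‖ ≤ (R * (L ^ 2 * p.h ^ 2)) * ‖p.ξ - p'.ξ‖ := by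
            gcongr
            exact h2.trans hRsq
        _ = R * L ^ 2 * p.h * (p.h * ‖p.ξ - p'.ξ‖) := by ring
        _ ≤ R * L ^ 2 * p.h * K := by gcongr
        _ = _ := by ring
    have h6 := mul_le_mul_of_nonneg_left hL hR
    nlinarith

/-- If two parameters are far apart, then at least one of two truncated transported profiles is
small on the intersection of their tubes. -/
theorem exists_gap_overlap_le (hd : 1 ≤ d) {q r : ℝ≥0∞} (hq0 : q ≠ 0) (hq : q ≠ ∞) (hr0 : r ≠ 0)
    (hr : r ≠ ∞) (hadm : 2 / q.toReal + (d : ℝ) / r.toReal = d / 2)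
    (R : ℕ) {ε : ℝ} (hε : 0 < ε) :
    ∃ K₀ : ℝ, ∀ (F G : ℝ → Space d → ℝ≥0∞) (p p' : Param d),
      K₀ ≤ scaleGap p p' ∨ K₀ ≤ centreGap p p' →
      mixed q r (cut (tube R p ∩ tube R p') (transport p (trunc F R))) ≤ ENNReal.ofReal ε ∨
      mixed q r (cut (tube R p ∩ tube R p') (transport p' (trunc G R))) ≤ ENNReal.ofReal ε := by
  have hq' : 0 < q.toReal := ENNReal.toReal_pos hq0 hq
  have hd' : (0 : ℝ) < (d : ℝ) / 2 := by positivity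
  set C := overlapConst d q r R
  have hC : 0 ≤ C := overlapConst_nonneg d q r R
  -- `L` bounds the ratio of comparable scales, `K` the comparable velocities
  obtain ⟨L, hL, hL1⟩ : ∃ L : ℝ, C * (L⁻¹) ^ ((d : ℝ) / 2) * 2 ^ (1 / q.toReal) ≤ ε ∧ 1 ≤ L := by
    have h1 : Tendsto (fun L : ℝ => C * (L⁻¹) ^ ((d : ℝ) / 2) * 2 ^ (1 / q.toReal)) atTop
        (𝓝 (C * (0 : ℝ) ^ ((d : ℝ) / 2) * 2 ^ (1 / q.toReal))) :=
      ((tendsto_inv_atTop_zero.rpow_const (Or.inr hd'.le)).const_mul C).mul_const _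
    rw [Real.zero_rpow hd'.ne', mul_zero, zero_mul] at h1
    exact ((h1.eventually (ge_mem_nhds hε)).and (eventually_ge_atTop 1)).exists
  obtain ⟨K, hK, hK0⟩ : ∃ K : ℝ, C * ((1 + L) * K⁻¹) ^ (1 / q.toReal) ≤ ε ∧ 0 < K := by
    have h1 : Tendsto (fun K : ℝ => C * ((1 + L) * K⁻¹) ^ (1 / q.toReal)) atTop
        (𝓝 (C * ((1 + L) * 0) ^ (1 / q.toReal))) :=
      ((tendsto_inv_atTop_zero.const_mul (1 + L)).rpow_const (Or.inr (by positivity))).const_mul C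
    rw [mul_zero, Real.zero_rpow (by positivity), mul_zero] at h1
    exact ((h1.eventually (ge_mem_nhds hε)).and (eventually_gt_atTop 0)).exists
  have hsmall : ∀ {a : ℝ}, 0 ≤ a → a ≤ L⁻¹ →
      ENNReal.ofReal (C * a ^ ((d : ℝ) / 2) * 2 ^ (1 / q.toReal)) ≤ ENNReal.ofReal ε := by
    intro a ha0 ha
    refine ENNReal.ofReal_le_ofReal (le_trans ?_ hL)
    gcongr
  refine ⟨max (2 * L + K) (R * (1 + L ^ 2) + (R * (1 + L) + 2 * R * L ^ 2 * K)) + 1,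
    fun F G p p' hgap => ?_⟩
  have hh := p.h_pos
  have hh' := p'.h_pos
  have hL0 : 0 < L := one_pos.trans_le hL1
  rcases le_or_gt (p'.h * L) p.h with hA | hA
  · left
    refine (mixed_cut_le hq0 hq hr0 hr hadm F R p p' (ρ := p'.h) (κ := 2) (Or.inr rfl) (by norm_num)
      (volume_overlapTimes_le_right p p')).trans (hsmall (by positivity) ?_)
    rw [div_le_iff₀ hh, inv_mul_eq_div, le_div_iff₀ hL0]
    exact hA
  rcases le_or_gt (p.h * L) p'.h with hB | hB
  · right
    rw [Set.inter_comm]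
    refine (mixed_cut_le hq0 hq hr0 hr hadm G R p' p (ρ := p.h) (κ := 2) (Or.inr rfl) (by norm_num)
      (volume_overlapTimes_le_right p' p)).trans (hsmall (by positivity) ?_)
    rw [div_le_iff₀ hh', inv_mul_eq_div, le_div_iff₀ hL0]
    exact hB
  left
  rcases le_or_gt K (p.h * ‖p.ξ - p'.ξ‖) with hξ | hξ
  · have hξ0 : 0 < ‖p.ξ - p'.ξ‖ := by
      by_contra h
      have : ‖p.ξ - p'.ξ‖ = 0 := le_antisymm (not_lt.1 h) (norm_nonneg _)
      rw [this, mul_zero] at hξ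
      linarith
    refine (mixed_cut_le hq0 hq hr0 hr hadm F R p p' (ρ := p.h) (κ := (1 + L) * K⁻¹) (Or.inl rfl)
      (by positivity) ((volume_overlapTimes_le_of_pos p p' hξ0).trans
        (ENNReal.ofReal_le_ofReal ?_))).trans (ENNReal.ofReal_le_ofReal ?_)
    · rw [mul_div_assoc]
      gcongr
      rw [div_le_iff₀ hξ0]
      calc p.h + p'.h ≤ (1 + L) * p.h := by linarith
        _ = (1 + L) * K⁻¹ * p.h * K := by field_simp
        _ ≤ (1 + L) * K⁻¹ * p.h * (p.h * ‖p.ξ - p'.ξ‖) := by gcongr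
        _ = _ := by ring
    · rw [div_self hh.ne', Real.one_rpow, mul_one]
      exact hK
  · have hempty : ∀ t x, (t, x) ∉ tube R p ∩ tube R p' := by
      intro t x hx
      have h1 := centreGap_le_of_mem_tube (K := K) (Nat.cast_nonneg R)
        (by linarith : p'.h ≤ L * p.h) hξ.le (mem_overlapTimes hx)
      have h2 : scaleGap p p' ≤ 2 * L + K := by
        have e1 : p'.h / p.h ≤ L := (div_le_iff₀ hh).2 (by linarith)
        have e2 : p.h / p'.h ≤ L := (div_le_iff₀ hh').2 (by linarith)
        unfold scaleGap
        linarith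
      have m1 := le_max_left (2 * L + K) (R * (1 + L ^ 2) + (R * (1 + L) + 2 * R * L ^ 2 * K))
      have m2 := le_max_right (2 * L + K) (R * (1 + L ^ 2) + (R * (1 + L) + 2 * R * L ^ 2 * K))
      rcases hgap with h | h <;> linarith
    have : cut (tube R p ∩ tube R p') (transport p (trunc F R)) = fun _ _ => 0 := by
      ext t x
      exact Set.indicator_of_notMem (hempty t x) _
    rw [this, mixed_zero]
    exact zero_le

/-- Along orthogonal sequences of parameters, at every late index one of two truncated transported
profiles is small on the intersection of their tubes. -/
theorem eventually_overlap_le (hd : 1 ≤ d) {q r : ℝ≥0∞} (hq0 : q ≠ 0) (hq : q ≠ ∞) (hr0 : r ≠ 0)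
    (hr : r ≠ ∞) (hadm : 2 / q.toReal + (d : ℝ) / r.toReal = d / 2)
    {Γ Γ' : ℕ → Param d} (horth : Orthogonal Γ Γ')
    (F G : ℝ → Space d → ℝ≥0∞) (R : ℕ) {ε : ℝ} (hε : 0 < ε) :
    ∀ᶠ n in atTop,
      mixed q r (cut (tube R (Γ n) ∩ tube R (Γ' n)) (transport (Γ n) (trunc F R)))
        ≤ ENNReal.ofReal ε ∨
      mixed q r (cut (tube R (Γ n) ∩ tube R (Γ' n)) (transport (Γ' n) (trunc G R)))
        ≤ ENNReal.ofReal ε := by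
  obtain ⟨K₀, hK₀⟩ := exists_gap_overlap_le hd hq0 hq hr0 hr hadm R hε
  rcases horth with h | h
  · filter_upwards [h.eventually_ge_atTop K₀] with n hn using hK₀ F G _ _ (Or.inl hn)
  · filter_upwards [h.eventually_ge_atTop K₀] with n hn using hK₀ F G _ _ (Or.inr hn)

/-! ### Decoupling for finite exponents -/

theorem mixed_transport_of_admissible (p : Param d) {q r : ℝ≥0∞} (hq0 : q ≠ 0) (hq : q ≠ ∞)
    (hr0 : r ≠ 0) (hr : r ≠ ∞) (hadm : 2 / q.toReal + (d : ℝ) / r.toReal = d / 2)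
    {F : ℝ → Space d → ℝ≥0∞} (hF : Measurable (Function.uncurry F)) :
    mixed q r (transport p F) = mixed q r F := by
  rw [mixed_transport p hq0 hq hr0 hr hF, hadm, sub_self, Real.rpow_zero, ENNReal.ofReal_one,
    one_mul]

theorem cut_le (A : Set (ℝ × Space d)) (F : ℝ → Space d → ℝ≥0∞) (t : ℝ) (x : Space d) :
    cut A F t x ≤ F t x :=
  Set.indicator_le_self' (fun _ _ => zero_le) (t, x)

/-- Functions whose pairwise overlaps are negligible on one side are almost disjointly supported:
their sum almost obeys the `ℓ^{min q r}` bound. -/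
theorem mixed_sum_le_of_overlap {q r : ℝ≥0∞} (hq1 : 1 ≤ q) (hq : q ≠ ∞) (hr1 : 1 ≤ r)
    (hr : r ≠ ∞) {ι : Type*} [Fintype ι] {f : ι → ℝ → Space d → ℝ≥0∞}
    (hf : ∀ j, Measurable (Function.uncurry (f j)))
    {A : ι → Set (ℝ × Space d)} (hA : ∀ j, MeasurableSet (A j))
    (hsupp : ∀ j t x, (t, x) ∉ A j → f j t x = 0) {ε : ℝ≥0∞}
    (hov : ∀ j k, j ≠ k → mixed q r (cut (A j ∩ A k) (f j)) ≤ ε ∨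
      mixed q r (cut (A j ∩ A k) (f k)) ≤ ε) :
    mixed q r (fun t x => ∑ j, f j t x) ≤
      (∑ j, mixed q r (f j) ^ (min q r).toReal) ^ (1 / (min q r).toReal) +
        ∑ _j : ι, ∑ _k : ι, ε := by
  classical
  have hq0 : q ≠ 0 := (one_pos.trans_le hq1).ne'
  have hr0 : r ≠ 0 := (one_pos.trans_le hr1).ne'
  have hm : 0 < (min q r).toReal :=
    ENNReal.toReal_pos (by simp [min_eq_iff, hq0, hr0]) (by simp [hq])
  -- the part of the overlap of `j` and `k` that is removed from `f j`
  let E : ι → ι → Set (ℝ × Space d) := fun j k =>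
    if k ≠ j ∧ mixed q r (cut (A j ∩ A k) (f j)) ≤ ε then A j ∩ A k else ∅
  have hE : ∀ j k, MeasurableSet (E j k) := by
    intro j k
    by_cases h : k ≠ j ∧ mixed q r (cut (A j ∩ A k) (f j)) ≤ ε
    · simpa only [E, if_pos h] using (hA j).inter (hA k)
    · simp only [E, if_neg h, MeasurableSet.empty]
  have hEs : ∀ j k, mixed q r (cut (E j k) (f j)) ≤ ε := by
    intro j k
    by_cases h : k ≠ j ∧ mixed q r (cut (A j ∩ A k) (f j)) ≤ ε
    · simpa only [E, if_pos h] using h.2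
    · have : cut (E j k) (f j) = fun _ _ => 0 := by
        ext t x
        simp [E, if_neg h, cut]
      rw [this, mixed_zero]
      exact zero_le
  let B : ι → Set (ℝ × Space d) := fun j => ⋃ k, E j k
  have hB : ∀ j, MeasurableSet (B j) := fun j => MeasurableSet.iUnion (hE j)
  have hg : ∀ j, Measurable (Function.uncurry (cut (B j)ᶜ (f j))) := fun j =>
    measurable_cut (hB j).compl (hf j)
  have he : ∀ j k, Measurable (Function.uncurry (cut (E j k) (f j))) := fun j k =>
    measurable_cut (hE j k) (hf j)
  have hdec : ∀ j t x, f j t x ≤ cut (B j)ᶜ (f j) t x + ∑ k, cut (E j k) (f j) t x := by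
    intro j t x
    by_cases h : (t, x) ∈ B j
    · obtain ⟨k, hk⟩ := Set.mem_iUnion.1 h
      refine le_add_left (le_trans ?_ (Finset.single_le_sum (f := fun k => cut (E j k) (f j) t x)
        (fun _ _ => zero_le) (Finset.mem_univ k)))
      simp only [cut, Set.indicator_of_mem hk]
      exact le_rfl
    · refine le_add_right ?_
      have h' : (t, x) ∈ (B j)ᶜ := h
      simp only [cut, Set.indicator_of_mem h']
      exact le_rfl
  have hdisj : ∀ j k, j ≠ k → ∀ t x, cut (B j)ᶜ (f j) t x = 0 ∨ cut (B k)ᶜ (f k) t x = 0 := by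
    intro j k hjk t x
    by_cases hj : (t, x) ∈ A j
    swap
    · exact Or.inl (le_antisymm ((cut_le _ _ t x).trans (hsupp j t x hj).le) zero_le)
    by_cases hk : (t, x) ∈ A k
    swap
    · exact Or.inr (le_antisymm ((cut_le _ _ t x).trans (hsupp k t x hk).le) zero_le)
    rcases hov j k hjk with h | h
    · refine Or.inl (Set.indicator_of_notMem (Set.notMem_compl_iff.2 (Set.mem_iUnion.2 ⟨k, ?_⟩)) _)
      have hc : k ≠ j ∧ mixed q r (cut (A j ∩ A k) (f j)) ≤ ε := ⟨hjk.symm, h⟩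
      simp only [E, if_pos hc]
      exact ⟨hj, hk⟩
    · refine Or.inr (Set.indicator_of_notMem (Set.notMem_compl_iff.2 (Set.mem_iUnion.2 ⟨j, ?_⟩)) _)
      rw [Set.inter_comm] at h
      have hc : j ≠ k ∧ mixed q r (cut (A k ∩ A j) (f k)) ≤ ε := ⟨hjk, h⟩
      simp only [E, if_pos hc]
      exact ⟨hk, hj⟩
  calc mixed q r (fun t x => ∑ j, f j t x)
      ≤ mixed q r (fun t x => (∑ j, cut (B j)ᶜ (f j) t x) + ∑ j, ∑ k, cut (E j k) (f j) t x) := by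
        refine mixed_mono fun t => ae_of_all _ fun x => ?_
        rw [← Finset.sum_add_distrib]
        exact Finset.sum_le_sum fun j _ => hdec j t x
    _ ≤ mixed q r (fun t x => ∑ j, cut (B j)ᶜ (f j) t x) +
        mixed q r (fun t x => ∑ j, ∑ k, cut (E j k) (f j) t x) :=
        mixed_add_le hq1 hr1 hr (measurable_uncurry_sum _ hg)
          (measurable_uncurry_sum _ fun j => measurable_uncurry_sum _ (he j))
    _ ≤ _ := by
        refine add_le_add ?_ ?_
        · rw [one_div, ENNReal.le_rpow_inv_iff hm]
          refine (mixed_sum_rpow_le hq0 hq hr0 hr _ hg hdisj).trans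
            (Finset.sum_le_sum fun j _ => ?_)
          exact ENNReal.rpow_le_rpow (mixed_mono fun t => ae_of_all _ fun x => cut_le _ _ t x) hm.le
        · refine (mixed_sum_le hq1 hr1 hr _ fun j => measurable_uncurry_sum _ (he j)).trans
            (Finset.sum_le_sum fun j _ => ?_)
          exact (mixed_sum_le hq1 hr1 hr _ (he j)).trans (Finset.sum_le_sum fun k _ => hEs j k)

/-- Asymptotic decoupling of transported space-time functions along orthogonal sequences. -/
theorem limsup_mixed_sum_transport_le (hd : 1 ≤ d) {q r : ℝ≥0∞} (hq1 : 1 ≤ q) (hq : q ≠ ∞)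
    (hr1 : 1 ≤ r) (hr : r ≠ ∞) (hadm : 2 / q.toReal + (d : ℝ) / r.toReal = d / 2)
    {ι : Type*} [Fintype ι] {F : ι → ℝ → Space d → ℝ≥0∞}
    (hF : ∀ j, Measurable (Function.uncurry (F j))) (hfin : ∀ j t x, F j t x ≠ ∞)
    {Γ : ι → ℕ → Param d} (horth : ∀ j k, j ≠ k → Orthogonal (Γ j) (Γ k)) :
    limsup (fun n => mixed q r (fun t x => ∑ j, transport (Γ j n) (F j) t x) ^
      (min q r).toReal) atTop ≤ ∑ j, mixed q r (F j) ^ (min q r).toReal := by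
  have hq0 : q ≠ 0 := (one_pos.trans_le hq1).ne'
  have hr0 : r ≠ 0 := (one_pos.trans_le hr1).ne'
  set m := (min q r).toReal
  have hm : 0 < m :=
    ENNReal.toReal_pos (by simp [min_eq_iff, hq0, hr0]) (by simp [hq])
  by_cases htop : ∃ j, mixed q r (F j) = ∞
  · obtain ⟨j, hj⟩ := htop
    have : ∑ j, mixed q r (F j) ^ m = ∞ :=
      ENNReal.sum_eq_top.2 ⟨j, Finset.mem_univ j, by rw [hj, ENNReal.top_rpow_of_pos hm]⟩
    rw [this]
    exact le_top
  push Not at htop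
  set S := ∑ j, mixed q r (F j) ^ m
  have key : ∀ ε : ℝ, 0 < ε → limsup (fun n => mixed q r
      (fun t x => ∑ j, transport (Γ j n) (F j) t x) ^ m) atTop ≤
      (S ^ (1 / m) + ∑ _j : ι, ∑ _k : ι, ENNReal.ofReal ε + ∑ _j : ι, ENNReal.ofReal ε) ^ m := by
    intro ε hε
    obtain ⟨R, hR⟩ : ∃ R : ℕ, ∀ j, mixed q r (truncRest (F j) R) ≤ ENNReal.ofReal ε :=
      (eventually_all.2 fun j => (tendsto_mixed_truncRest hq0 hq hr0 hr (hF j) (hfin j)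
        (htop j)).eventually (ge_mem_nhds (ENNReal.ofReal_pos.2 hε))).exists
    have hov : ∀ᶠ n in atTop, ∀ j k, j ≠ k →
        mixed q r (cut (tube R (Γ j n) ∩ tube R (Γ k n)) (transport (Γ j n) (trunc (F j) R)))
          ≤ ENNReal.ofReal ε ∨
        mixed q r (cut (tube R (Γ j n) ∩ tube R (Γ k n)) (transport (Γ k n) (trunc (F k) R)))
          ≤ ENNReal.ofReal ε := by
      refine eventually_all.2 fun j => eventually_all.2 fun k => ?_
      by_cases hjk : j = k
      · exact Eventually.of_forall fun n h => absurd hjk h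
      · filter_upwards [eventually_overlap_le hd hq0 hq hr0 hr hadm (horth j k hjk) (F j) (F k) R
          hε] with n hn _ using hn
    refine limsup_le_of_le (by isBoundedDefault) ?_
    filter_upwards [hov] with n hn
    refine ENNReal.rpow_le_rpow ?_ hm.le
    have hU : ∀ j, Measurable (Function.uncurry (transport (Γ j n) (trunc (F j) R))) :=
      fun j => measurable_transport _ (measurable_trunc (hF j) R)
    have hW : ∀ j, Measurable (Function.uncurry (transport (Γ j n) (truncRest (F j) R))) :=
      fun j => measurable_transport _ (measurable_truncRest (hF j) R)
    calc mixed q r (fun t x => ∑ j, transport (Γ j n) (F j) t x)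
        = mixed q r (fun t x => (∑ j, transport (Γ j n) (trunc (F j) R) t x) +
            ∑ j, transport (Γ j n) (truncRest (F j) R) t x) := by
          congr 1
          ext t x
          rw [← Finset.sum_add_distrib]
          refine Finset.sum_congr rfl fun j _ => ?_
          rw [← transport_add]
          congr 1
          ext t x
          exact trunc_add_truncRest _ _ _ _
      _ ≤ _ := mixed_add_le hq1 hr1 hr (measurable_uncurry_sum _ hU) (measurable_uncurry_sum _ hW)
      _ ≤ _ := by
          refine add_le_add ((mixed_sum_le_of_overlap hq1 hq hr1 hr hU
            (fun j => measurableSet_tube R (Γ j n))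
            (fun j t x => transport_trunc_eq_zero (Γ j n) (F j) R) hn).trans ?_)
            ((mixed_sum_le hq1 hr1 hr _ hW).trans (Finset.sum_le_sum fun j _ => ?_))
          · refine add_le_add (ENNReal.rpow_le_rpow (Finset.sum_le_sum fun j _ =>
              ENNReal.rpow_le_rpow ?_ hm.le) (one_div_nonneg.2 hm.le)) le_rfl
            rw [mixed_transport_of_admissible _ hq0 hq hr0 hr hadm (measurable_trunc (hF j) R)]
            exact mixed_mono fun t => ae_of_all _ fun x => trunc_le _ _ _ _
          · rw [mixed_transport_of_admissible _ hq0 hq hr0 hr hadm (measurable_truncRest (hF j) R)]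
            exact hR j
  have hlim : Tendsto (fun ε : ℝ => (S ^ (1 / m) + ∑ _j : ι, ∑ _k : ι, ENNReal.ofReal ε +
      ∑ _j : ι, ENNReal.ofReal ε) ^ m) (𝓝[>] 0) (𝓝 S) := by
    have hc : Continuous fun ε : ℝ => (S ^ (1 / m) + ∑ _j : ι, ∑ _k : ι, ENNReal.ofReal ε +
        ∑ _j : ι, ENNReal.ofReal ε) ^ m := by
      refine ENNReal.continuous_rpow_const.comp ?_
      have := ENNReal.continuous_ofReal
      fun_prop
    have h0 := (hc.tendsto 0).mono_left (nhdsWithin_le_nhds (s := Set.Ioi 0))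
    have e : (S ^ (1 / m)) ^ m = S := by
      rw [← ENNReal.rpow_mul, one_div_mul_cancel hm.ne', ENNReal.rpow_one]
    rw [one_div] at e
    simpa [e] using h0
  exact ge_of_tendsto hlim (eventually_nhdsWithin_of_forall key)

/-- A finite-valued measurable space-time function that represents the modulus of the evolution of
`φ`. -/
theorem exists_modulus (φ : L2 d) : ∃ F : ℝ → Space d → ℝ≥0∞, Measurable (Function.uncurry F) ∧
    (∀ t x, F t x ≠ ∞) ∧ ∀ t, ∀ᵐ x, F t x = ‖propagator t φ x‖ₑ := by
  obtain ⟨U, hU, hae⟩ := exists_measurable_representative (continuous_propagator φ)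
  exact ⟨fun t x => ‖U t x‖ₑ, hU.enorm, fun t x => enorm_ne_top,
    fun t => (hae t).mono fun x hx => congrArg enorm hx⟩

theorem mixedNorm_eq_mixed {q r : ℝ≥0∞} {u : ℝ → L2 d} {F : ℝ → Space d → ℝ≥0∞}
    (h : ∀ t, ∀ᵐ x, F t x = ‖u t x‖ₑ) : mixedNorm q r u = mixed q r F := by
  unfold mixedNorm mixed
  congr 1
  ext t
  rw [← eLpNorm_enorm]
  exact eLpNorm_congr_ae ((h t).mono fun x hx => hx.symm)

theorem transport_eq_enorm_ae (p : Param d) {φ : L2 d} {F : ℝ → Space d → ℝ≥0∞}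
    (h : ∀ t, ∀ᵐ x, F t x = ‖propagator t φ x‖ₑ) (t : ℝ) :
    ∀ᵐ x, transport p F t x = ‖propagator t (symm 0 p φ) x‖ₑ := by
  filter_upwards [norm_propagator_symm_ae 0 p φ t,
    (quasiMeasurePreserving_affine p.h_pos (p.x + (2 * t) • p.ξ)).ae
      (h ((t - p.t) / p.h ^ 2))] with x h1 h2
  rw [transport, h2, ← ofReal_norm, ← ofReal_norm, h1, ENNReal.ofReal_mul]
  have := p.h_pos
  positivity

/-- Decoupling for finite exponents. The evolution of the sum is bounded pointwise by the sum of the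
transported moduli, so the phases are discarded. -/
theorem limsup_mixedNorm_le (hd : 1 ≤ d) {q r : ℝ≥0∞} (hq1 : 1 ≤ q) (hq : q ≠ ∞)
    (hr1 : 1 ≤ r) (hr : r ≠ ∞) (hadm : 2 / q.toReal + (d : ℝ) / r.toReal = d / 2)
    {ι : Type*} [Fintype ι] (φ : ι → L2 d)
    {Γ : ι → ℕ → Param d} (horth : ∀ j k, j ≠ k → Orthogonal (Γ j) (Γ k)) :
    limsup (fun n => mixedNorm q r (fun t => ∑ j, propagator t (symm 0 (Γ j n) (φ j))) ^
      (min q r).toReal) atTop ≤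
      ∑ j, mixedNorm q r (fun t => propagator t (φ j)) ^ (min q r).toReal := by
  choose F hF hfin hFe using fun j => exists_modulus (φ j)
  refine le_trans (limsup_le_limsup (Eventually.of_forall fun n => ?_))
    ((limsup_mixed_sum_transport_le hd hq1 hq hr1 hr hadm hF hfin horth).trans_eq ?_)
  · refine ENNReal.rpow_le_rpow ?_ ENNReal.toReal_nonneg
    rw [mixedNorm_eq_mixed (F := fun t x => ‖(∑ j, propagator t (symm 0 (Γ j n) (φ j)) : L2 d) x‖ₑ)
      fun t => ae_of_all _ fun x => rfl]
    refine mixed_mono fun t => ?_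
    filter_upwards [Lp.coeFn_finsetSum Finset.univ fun j => propagator t (symm 0 (Γ j n) (φ j)),
      ae_all_iff.2 fun j => transport_eq_enorm_ae (Γ j n) (hFe j) t] with x h1 h2
    rw [h1]
    simp only [Finset.sum_apply, h2]
    exact enorm_sum_le _ _
  · exact Finset.sum_congr rfl fun j _ => by rw [mixedNorm_eq_mixed (hFe j)]

/-! ### Gaussians -/

/-- The Gaussian `e^{-π‖x‖²}`, which is its own Fourier transform. -/
def gaussian (d : ℕ) (x : Space d) : ℂ := Complex.exp (-(Real.pi : ℂ) * (‖x‖ : ℂ) ^ 2)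

theorem continuous_gaussian : Continuous (gaussian d) := by
  unfold gaussian
  fun_prop

theorem norm_cexp_neg_mul_sq (b : ℂ) (x : Space d) :
    ‖Complex.exp (-b * (‖x‖ : ℂ) ^ 2)‖ = Real.exp (-b.re * ‖x‖ ^ 2) := by
  rw [Complex.norm_exp]
  congr 1
  rw [← Complex.ofReal_pow, Complex.re_mul_ofReal, Complex.neg_re]

theorem norm_gaussian (x : Space d) : ‖gaussian d x‖ = Real.exp (-Real.pi * ‖x‖ ^ 2) := by
  rw [gaussian, norm_cexp_neg_mul_sq, Complex.ofReal_re]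

theorem integrable_cexp_neg_mul_sq {b : ℂ} (hb : 0 < b.re) :
    Integrable fun x : Space d => Complex.exp (-b * (‖x‖ : ℂ) ^ 2) := by
  simpa using GaussianFourier.integrable_cexp_neg_mul_sq_norm_add hb 0 (0 : Space d)

theorem integrable_rexp_neg_mul_sq {b : ℝ} (hb : 0 < b) :
    Integrable fun x : Space d => Real.exp (-b * ‖x‖ ^ 2) := by
  have := (integrable_cexp_neg_mul_sq (d := d) (b := (b : ℂ)) (by simpa using hb)).norm
  simpa only [norm_cexp_neg_mul_sq, Complex.ofReal_re] using this

theorem memLp_gaussian : MemLp (gaussian d) 2 (volume : Measure (Space d)) := by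
  rw [memLp_two_iff_integrable_sq_norm continuous_gaussian.aestronglyMeasurable]
  refine (integrable_rexp_neg_mul_sq (d := d) (b := 2 * Real.pi) (by positivity)).congr
    (ae_of_all _ fun x => ?_)
  simp only
  rw [norm_gaussian, ← Real.exp_nat_mul]
  congr 1
  push_cast
  ring

/-- The Gaussian as an element of `L²`. -/
def gaussianL2 (d : ℕ) : L2 d := (memLp_gaussian (d := d)).toLp _

theorem gaussianL2_ae : gaussianL2 d =ᵐ[volume] gaussian d := memLp_gaussian.coeFn_toLp

theorem fourier_gaussianL2_ae : (𝓕 (gaussianL2 d) : L2 d) =ᵐ[volume] gaussian d := by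
  refine (fourier_ae gaussianL2_ae (integrable_cexp_neg_mul_sq (by simp [Real.pi_pos]))).trans
    (ae_of_all _ fun x => ?_)
  have hπ : (Real.pi : ℂ) ≠ 0 := by exact_mod_cast Real.pi_ne_zero
  have := fourier_gaussian_innerProductSpace (b := (Real.pi : ℂ)) (by simp [Real.pi_pos]) x
  refine this.trans ?_
  rw [div_self hπ, Complex.one_cpow, one_mul, gaussian]
  congr 1
  field_simp

/-- The evolution of the Gaussian decays at the dispersive rate. -/
theorem norm_propagator_gaussianL2_ae (t : ℝ) : ∀ᵐ x, ‖propagator t (gaussianL2 d) x‖ =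
    (1 + (4 * Real.pi * t) ^ 2) ^ (-((d : ℝ) / 4)) *
      Real.exp (-(Real.pi / (1 + (4 * Real.pi * t) ^ 2)) * ‖x‖ ^ 2) := by
  have hpi := Real.pi_pos
  have hπ : (Real.pi : ℂ) ≠ 0 := by exact_mod_cast Real.pi_ne_zero
  set b : ℂ := Real.pi + (4 * Real.pi ^ 2 * t : ℝ) * Complex.I with hb
  set D : ℝ := 1 + (4 * Real.pi * t) ^ 2 with hD
  have hD0 : 0 < D := by positivity
  have hbre : b.re = Real.pi := by
    rw [hb, Complex.add_re, Complex.ofReal_re, Complex.re_ofReal_mul, Complex.I_re, mul_zero,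
      add_zero]
  have hbim : b.im = 4 * Real.pi ^ 2 * t := by
    rw [hb, Complex.add_im, Complex.ofReal_im, Complex.im_ofReal_mul, Complex.I_im, mul_one,
      zero_add]
  have hsq : Complex.normSq b = Real.pi ^ 2 * D := by
    rw [Complex.normSq_apply, hbre, hbim, hD]
    ring
  have hnorm : ‖(Real.pi : ℂ) / b‖ = D ^ (-(1 / 2 : ℝ)) := by
    rw [norm_div, Complex.norm_real, Real.norm_of_nonneg hpi.le, Complex.norm_def, hsq,
      Real.sqrt_mul (by positivity), Real.sqrt_sq hpi.le, Real.rpow_neg hD0.le,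
      ← Real.sqrt_eq_rpow, div_mul_eq_div_div, div_self hpi.ne', one_div]
  have h1 : phaseMul _ (continuous_freePhase t) (𝓕 (gaussianL2 d)) =ᵐ[volume]
      fun x => Complex.exp (-b * (‖x‖ : ℂ) ^ 2) := by
    filter_upwards [phaseMul_ae (continuous_freePhase t) (𝓕 (gaussianL2 d)),
      fourier_gaussianL2_ae] with x e1 e2
    rw [e1, e2, gaussian, ← Complex.exp_add]
    congr 1
    rw [norm_smul, Real.norm_of_nonneg (by positivity : (0:ℝ) ≤ 2 * Real.pi), hb]
    push_cast
    ring
  filter_upwards [fourierInv_ae h1 (integrable_cexp_neg_mul_sq (hbre ▸ hpi))] with x hx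
  refine (congrArg norm hx).trans ?_
  rw [fourier_gaussian_innerProductSpace (hbre ▸ hpi), norm_mul]
  congr 1
  · have : ((Module.finrank ℝ (Space d) : ℂ) / 2) = (((d : ℝ) / 2 : ℝ) : ℂ) := by
      rw [finrank_euclideanSpace_fin]
      push_cast
      rfl
    rw [this, Complex.norm_cpow_real, hnorm, ← Real.rpow_mul hD0.le]
    congr 1
    ring
  · rw [Complex.norm_exp, norm_neg]
    congr 1
    have : -(Real.pi : ℂ) ^ 2 * (‖x‖ : ℂ) ^ 2 / b = ((-Real.pi ^ 2 * ‖x‖ ^ 2 : ℝ) : ℂ) * b⁻¹ := by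
      push_cast
      rw [div_eq_mul_inv]
    rw [this, Complex.re_ofReal_mul, Complex.inv_re, hbre, hsq]
    field_simp

/-- The exponent `2 + 4/d` of the diagonal admissible pair. -/
def diagExp (d : ℕ) : ℝ≥0∞ := ENNReal.ofReal (2 + 4 / (d : ℝ))

theorem diagExp_toReal : (diagExp d).toReal = 2 + 4 / (d : ℝ) :=
  ENNReal.toReal_ofReal (by positivity)

theorem one_le_diagExp : 1 ≤ diagExp d := by
  rw [← ENNReal.ofReal_one]
  refine ENNReal.ofReal_le_ofReal ?_
  have : 0 ≤ 4 / (d : ℝ) := by positivity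
  linarith

theorem diagExp_ne_top : diagExp d ≠ ∞ := ENNReal.ofReal_ne_top

theorem diagExp_ne_zero : diagExp d ≠ 0 := (one_pos.trans_le one_le_diagExp).ne'

theorem diagExp_admissible (hd : 1 ≤ d) :
    2 / (diagExp d).toReal + (d : ℝ) / (diagExp d).toReal = d / 2 := by
  have : (0 : ℝ) < d := by exact_mod_cast hd
  rw [diagExp_toReal]
  field_simp
  ring

theorem mixed_diag_eq {p : ℝ≥0∞} (hp0 : p ≠ 0) (hp : p ≠ ∞) (F : ℝ → Space d → ℝ≥0∞) :
    mixed p p F = (∫⁻ t, ∫⁻ x, F t x ^ p.toReal) ^ (1 / p.toReal) := by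
  rw [mixed_eq_lintegral hp0 hp hp0 hp, div_self (ENNReal.toReal_pos hp0 hp).ne']
  simp only [ENNReal.rpow_one]

/-- The evolution of the Gaussian lies in `L^p_{t,x}`, `p = 2 + 4/d`: the integral of its `p`-th
power over `x` is a multiple of `(1 + (4πt)²)⁻¹`. -/
theorem mixedNorm_gaussianL2_ne_top (hd : 1 ≤ d) :
    mixedNorm (diagExp d) (diagExp d) (fun t => propagator t (gaussianL2 d)) ≠ ∞ := by
  have hd0 : (0 : ℝ) < d := by exact_mod_cast hd
  have hpi := Real.pi_pos
  set P := (diagExp d).toReal with hP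
  have hPe : P = 2 + 4 / (d : ℝ) := diagExp_toReal
  have hP0 : 0 < P := by rw [hPe]; positivity
  rw [mixedNorm_eq_mixed (F := fun t x => ‖propagator t (gaussianL2 d) x‖ₑ)
    fun t => ae_of_all _ fun x => rfl, mixed_diag_eq diagExp_ne_zero diagExp_ne_top]
  refine ENNReal.rpow_ne_top_of_nonneg (by positivity) ?_
  have hslice : ∀ t : ℝ, ∫⁻ x, ‖propagator t (gaussianL2 d) x‖ₑ ^ P
      = ENNReal.ofReal (P⁻¹ ^ ((d : ℝ) / 2) * (1 + (4 * Real.pi * t) ^ 2)⁻¹) := by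
    intro t
    set D : ℝ := 1 + (4 * Real.pi * t) ^ 2 with hD
    have hD0 : 0 < D := by positivity
    have hb : 0 < P * Real.pi / D := by positivity
    have e1 : ∀ᵐ x, ‖propagator t (gaussianL2 d) x‖ₑ ^ P
        = ENNReal.ofReal (D ^ (-((d : ℝ) / 2 + 1)) * Real.exp (-(P * Real.pi / D) * ‖x‖ ^ 2)) := by
      filter_upwards [norm_propagator_gaussianL2_ae (d := d) t] with x hx
      rw [← ofReal_norm, hx, ENNReal.ofReal_rpow_of_nonneg (by positivity) hP0.le,
        Real.mul_rpow (by positivity) (by positivity), ← Real.rpow_mul hD0.le, ← Real.exp_mul]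
      congr 3
      · rw [hPe]
        field_simp
        ring
      · ring
    rw [lintegral_congr_ae e1, ← ofReal_integral_eq_lintegral_ofReal
      ((integrable_rexp_neg_mul_sq hb).const_mul _) (ae_of_all _ fun x => by positivity),
      integral_const_mul, GaussianFourier.integral_rexp_neg_mul_sq_norm hb,
      finrank_euclideanSpace_fin]
    congr 1
    have e2 : Real.pi / (P * Real.pi / D) = P⁻¹ * D := by field_simp
    rw [e2, Real.mul_rpow (by positivity) hD0.le, mul_left_comm, ← Real.rpow_add hD0]
    congr 1
    rw [← Real.rpow_neg_one]
    congr 1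
    ring
  simp only [← hP, hslice]
  have hi : Integrable fun t : ℝ => P⁻¹ ^ ((d : ℝ) / 2) * (1 + (4 * Real.pi * t) ^ 2)⁻¹ :=
    (integrable_inv_one_add_sq.comp_mul_left' (R := 4 * Real.pi) (by positivity)).const_mul _
  exact hi.lintegral_lt_top.ne

theorem eLpNorm_propagator_modulate {p : ℝ≥0∞} (hp : p ≠ ∞) (t : ℝ) (ξ : Space d) (f : L2 d) :
    eLpNorm (propagator t (phaseMul _ (continuous_modPhase 0 ξ) f)) p volume
      = eLpNorm (propagator t f) p volume := by
  rw [propagator_modulate]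
  have h1 := eLpNorm_comp_affine (volume : Measure (Space d)) hp one_pos ((2 * t) • ξ)
    (Lp.aestronglyMeasurable (propagator t f))
  rw [Real.one_rpow, ENNReal.ofReal_one, one_mul] at h1
  rw [← h1]
  refine eLpNorm_congr_norm_ae ?_
  filter_upwards [phaseMul_ae (continuous_modPhase (0 - t * ‖ξ‖ ^ 2) ξ)
        (dilate 1 one_pos ((2 * t) • ξ) (propagator t f)),
    dilate_ae one_pos ((2 * t) • ξ) (propagator t f)] with x e1 e2
  rw [e1, e2, norm_mul, mul_comm Complex.I, Complex.norm_exp_ofReal_mul_I, one_mul, norm_mul]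
  simp

/-- The span of the modulated Gaussians. -/
def gaussianSpan (d : ℕ) : Submodule ℂ (L2 d) :=
  Submodule.span ℂ (Set.range fun ξ : Space d =>
    phaseMul _ (continuous_modPhase 0 ξ) (gaussianL2 d))

/-- The modulated Gaussians are total in `L²`: for `f` orthogonal to all of them, the Fourier
transform of `f` times the Gaussian vanishes. -/
theorem dense_gaussianSpan : Dense (gaussianSpan d : Set (L2 d)) := by
  rw [Submodule.dense_iff_topologicalClosure_eq_top, Submodule.topologicalClosure_eq_top_iff,
    Submodule.eq_bot_iff]
  intro f hf
  have hpi := Real.pi_pos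
  have horth : ∀ ξ : Space d,
      inner ℂ (phaseMul _ (continuous_modPhase 0 ξ) (gaussianL2 d)) f = 0 := fun ξ =>
    (Submodule.mem_orthogonal _ _).1 hf _ (Submodule.subset_span ⟨ξ, rfl⟩)
  set H : Space d → ℂ := fun x => gaussian d x * f x with hH
  have hHi : Integrable H := MemLp.integrable_mul memLp_gaussian (Lp.memLp f)
  have hH2 : MemLp H 2 (volume : Measure (Space d)) := by
    refine MemLp.of_le (Lp.memLp f)
      (continuous_gaussian.aestronglyMeasurable.mul (Lp.aestronglyMeasurable f))
      (ae_of_all _ fun x => ?_)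
    rw [hH, norm_mul, norm_gaussian]
    refine mul_le_of_le_one_left (norm_nonneg _) (Real.exp_le_one_iff.2 ?_)
    have : 0 ≤ Real.pi * ‖x‖ ^ 2 := by positivity
    linarith
  have hFour : 𝓕 H = 0 := by
    ext η
    have h1 := horth ((2 * Real.pi) • η)
    rw [L2.inner_def] at h1
    rw [Real.fourier_eq', Pi.zero_apply, ← h1]
    refine integral_congr_ae ?_
    filter_upwards [phaseMul_ae (continuous_modPhase 0 ((2 * Real.pi) • η)) (gaussianL2 d),
      gaussianL2_ae (d := d)] with x e1 e2
    have c1 : (starRingEnd ℂ) (Complex.exp (Complex.I *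
        ((0 + inner ℝ x ((2 * Real.pi) • η) : ℝ) : ℂ)))
        = Complex.exp (((-2 * Real.pi * inner ℝ x η : ℝ) : ℂ) * Complex.I) := by
      rw [← Complex.exp_conj, map_mul, Complex.conj_ofReal, Complex.conj_I, real_inner_smul_right]
      congr 1
      push_cast
      ring
    have c2 : (starRingEnd ℂ) (gaussian d x) = gaussian d x := by
      rw [gaussian, ← Complex.exp_conj, map_mul, map_neg, map_pow, Complex.conj_ofReal,
        Complex.conj_ofReal]
    rw [e1, e2, RCLike.inner_apply, map_mul, c1, c2, smul_eq_mul]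
    change _ * (gaussian d x * f x) = _
    ring
  have h2 : 𝓕 (hH2.toLp H) = (0 : L2 d) := by
    refine Lp.ext ((fourier_toLp_ae hH2 hHi).trans ?_)
    rw [hFour]
    exact (Lp.coeFn_zero _ _ _).symm
  have h3 : hH2.toLp H = 0 := by
    refine fourier_injective (h2.trans ?_)
    exact ((Lp.fourierTransformₗᵢ (Space d) ℂ).map_zero).symm
  refine Lp.ext ?_
  filter_upwards [hH2.coeFn_toLp, Lp.coeFn_zero ℂ 2 (volume : Measure (Space d))] with x e1 e2
  rw [h3, e2] at e1
  rw [e2]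
  exact (mul_eq_zero.1 e1.symm).resolve_left (Complex.exp_ne_zero _)

/-! ### Space-time pairings -/

/-- The space-time pairing of two `[0, ∞]`-valued functions. -/
def pairing (F G : ℝ → Space d → ℝ≥0∞) : ℝ≥0∞ := ∫⁻ t, ∫⁻ x, F t x * G t x

theorem pairing_mono {F G F' G' : ℝ → Space d → ℝ≥0∞}
    (h : ∀ t x, F t x * G t x ≤ F' t x * G' t x) : pairing F G ≤ pairing F' G' :=
  lintegral_mono fun t => lintegral_mono fun x => h t x

theorem pairing_add_left {F F' G : ℝ → Space d → ℝ≥0∞} (hF : Measurable (Function.uncurry F))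
    (hG : Measurable (Function.uncurry G)) :
    pairing (fun t x => F t x + F' t x) G = pairing F G + pairing F' G := by
  unfold pairing
  have hm : Measurable fun t => ∫⁻ x, F t x * G t x := (hF.mul hG).lintegral_prod_right'
  rw [← lintegral_add_left hm]
  refine lintegral_congr fun t => ?_
  have hm : Measurable fun x => F t x * G t x := (measurable_slice hF t).mul (measurable_slice hG t)
  rw [← lintegral_add_left hm]
  simp only [add_mul]

theorem pairing_comm (F G : ℝ → Space d → ℝ≥0∞) : pairing F G = pairing G F := by
  simp only [pairing, mul_comm]

/-- Hölder's inequality `L¹_t L²_x × L^∞_t L²_x`. -/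
theorem pairing_le_mixed_one_two {F G : ℝ → Space d → ℝ≥0∞} (hF : Measurable (Function.uncurry F))
    (hG : Measurable (Function.uncurry G)) {C : ℝ≥0∞} (hC : C ≠ ∞)
    (hGC : ∀ t, eLpNorm (G t) 2 volume ≤ C) : pairing F G ≤ C * mixed 1 2 F := by
  rw [mixed, eLpNorm_one_eq_lintegral_enorm, ← lintegral_const_mul' _ _ hC]
  refine lintegral_mono fun t => ?_
  have h := ENNReal.lintegral_mul_le_Lp_mul_Lq volume Real.HolderConjugate.two_two
    (measurable_slice hF t).aemeasurable (measurable_slice hG t).aemeasurable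
  have e : ∀ f : Space d → ℝ≥0∞,
      eLpNorm f 2 volume = (∫⁻ x, f x ^ (2 : ℝ)) ^ (1 / (2 : ℝ)) := fun f => by
    rw [eLpNorm_eq_lintegral_rpow_enorm_toReal (by norm_num) (by norm_num)]
    simp
  rw [← e, ← e, mul_comm (eLpNorm _ _ _)] at h
  rw [enorm_eq_self]
  exact h.trans (mul_le_mul_left (hGC t) _)

/-- The constant in the bound for the space-time volume of tubes. -/
def tubeConst (d R : ℕ) : ℝ :=
  2 * R * ((R : ℝ) ^ d * (volume (Metric.closedBall (0 : Space d) 1)).toReal)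

theorem tubeConst_nonneg (d R : ℕ) : 0 ≤ tubeConst d R := by
  unfold tubeConst
  positivity

theorem volume_tube_le (R : ℕ) (p : Param d) :
    ((volume : Measure ℝ).prod (volume : Measure (Space d))) (tube R p) ≤
      ENNReal.ofReal (tubeConst d R * p.h ^ ((d : ℝ) + 2)) := by
  have hh := p.h_pos
  set ω := (volume (Metric.closedBall (0 : Space d) 1)).toReal with hω
  have hω0 : 0 ≤ ω := ENNReal.toReal_nonneg
  rw [Measure.prod_apply (measurableSet_tube _ _)]
  calc ∫⁻ t, volume (Prod.mk t ⁻¹' tube R p)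
      ≤ ∫⁻ t, (Metric.closedBall p.t (R * p.h ^ 2)).indicator
          (fun _ => ENNReal.ofReal ((R * p.h) ^ d * ω)) t := by
        refine lintegral_mono fun t => ?_
        by_cases ht : t ∈ Metric.closedBall p.t (R * p.h ^ 2)
        · rw [Set.indicator_of_mem ht,
            ← volume_closedBall_le (p.x + (2 * t) • p.ξ) (by positivity)]
          exact measure_mono fun x hx => mem_closedBall_iff_norm.2 hx.2
        · have : Prod.mk t ⁻¹' tube R p = ∅ := by
            ext x
            simp only [Set.mem_preimage, Set.mem_empty_iff_false, iff_false]
            exact fun hx => ht hx.1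
          rw [this, measure_empty]
          exact zero_le
    _ = ENNReal.ofReal ((R * p.h) ^ d * ω) * ENNReal.ofReal (2 * (R * p.h ^ 2)) := by
        rw [lintegral_indicator_const Metric.isClosed_closedBall.measurableSet,
          Real.volume_closedBall]
    _ = _ := by
        rw [← ENNReal.ofReal_mul (by positivity)]
        congr 1
        rw [tubeConst, Real.rpow_add hh, Real.rpow_natCast, Real.rpow_two, mul_pow]
        ring

/-- Hölder's inequality on a tube, at the diagonal admissible exponent. -/
theorem pairing_le_of_tube (hd : 1 ≤ d) (R : ℕ) (p : Param d) {F G : ℝ → Space d → ℝ≥0∞}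
    (hF : Measurable (Function.uncurry F)) (hG : Measurable (Function.uncurry G))
    (hsupp : ∀ t x, (t, x) ∉ tube R p → F t x = 0) :
    pairing F G ≤ ENNReal.ofReal (tubeConst d R ^ (2 / ((d : ℝ) + 2)) * p.h ^ 2) *
      (mixed (diagExp d) (diagExp d) F * mixed (diagExp d) (diagExp d) G) := by
  have hh := p.h_pos
  have hd0 : (0 : ℝ) < d := by exact_mod_cast hd
  set P := (diagExp d).toReal with hP
  have hPe : P = 2 + 4 / (d : ℝ) := diagExp_toReal
  have hP0 : 0 < P := by rw [hPe]; positivity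
  set s : ℝ := 2 / ((d : ℝ) + 2) with hs
  set μ := (volume : Measure ℝ).prod (volume : Measure (Space d)) with hμ
  have hmixed : ∀ H : ℝ → Space d → ℝ≥0∞, Measurable (Function.uncurry H) →
      mixed (diagExp d) (diagExp d) H = (∫⁻ z, Function.uncurry H z ^ P ∂μ) ^ (1 / P) := by
    intro H hH
    rw [mixed_diag_eq diagExp_ne_zero diagExp_ne_top, hμ,
      lintegral_prod _ (hH.pow_const P).aemeasurable]
    rfl
  have hpair : pairing F G = ∫⁻ z, Function.uncurry F z * Function.uncurry G z ∂μ := by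
    have hm : Measurable fun z => Function.uncurry F z * Function.uncurry G z := hF.mul hG
    rw [hμ, lintegral_prod _ hm.aemeasurable]
    rfl
  have hsum : s + 1 / P + 1 / P = 1 := by
    rw [hs, hPe]
    field_simp
    ring
  have hholder := ENNReal.lintegral_prod_norm_pow_le (μ := μ) (Finset.univ : Finset (Fin 3))
    (f := ![(tube R p).indicator 1, fun z => Function.uncurry F z ^ P,
      fun z => Function.uncurry G z ^ P])
    (by
      intro i _
      fin_cases i
      · exact (measurable_one.indicator (measurableSet_tube _ _)).aemeasurable
      · exact (hF.pow_const P).aemeasurable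
      · exact (hG.pow_const P).aemeasurable)
    (p := ![s, 1 / P, 1 / P]) (by simpa [Fin.sum_univ_three] using hsum)
    (by
      intro i _
      fin_cases i
      · change 0 ≤ s; positivity
      · change 0 ≤ 1 / P; positivity
      · change 0 ≤ 1 / P; positivity)
  rw [Fin.prod_univ_three] at hholder
  simp only [Fin.prod_univ_three, Matrix.cons_val_zero, Matrix.cons_val_one,
    Matrix.cons_val] at hholder
  rw [hpair, hmixed F hF, hmixed G hG, ← mul_assoc]
  refine le_trans (lintegral_mono fun z => ?_) (hholder.trans ?_)
  · by_cases hz : z ∈ tube R p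
    · rw [Set.indicator_of_mem hz, Pi.one_apply, ENNReal.one_rpow, one_mul, ← ENNReal.rpow_mul,
        ← ENNReal.rpow_mul, mul_one_div_cancel hP0.ne', ENNReal.rpow_one, ENNReal.rpow_one]
    · have : Function.uncurry F z = 0 := hsupp z.1 z.2 hz
      rw [this, zero_mul]
      exact zero_le
  · rw [lintegral_indicator_one (measurableSet_tube _ _)]
    refine mul_le_mul_left (mul_le_mul_left ?_ _) _
    refine (ENNReal.rpow_le_rpow (volume_tube_le R p) (by positivity)).trans_eq ?_
    have hC := tubeConst_nonneg d R
    rw [ENNReal.ofReal_rpow_of_nonneg (by positivity) (by positivity),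
      Real.mul_rpow hC (by positivity), ← Real.rpow_mul hh.le, hs,
      mul_div_cancel₀ _ (by positivity),
      Real.rpow_two]

theorem trunc_trunc (F : ℝ → Space d → ℝ≥0∞) {R S : ℕ} (hRS : R ≤ S) :
    trunc (trunc F R) S = trunc F R := by
  ext t x
  have hRS' : (R : ℝ) ≤ S := by exact_mod_cast hRS
  by_cases h : (t, x) ∈ truncRegion F R
  · have e : trunc F R t x = F t x := if_pos h
    have : (t, x) ∈ truncRegion (trunc F R) S := by
      refine ⟨h.1.trans hRS', h.2.1.trans hRS', ?_⟩
      change trunc F R t x ≤ S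
      rw [e]
      exact h.2.2.trans (by exact_mod_cast hRS)
    exact if_pos this
  · have e : trunc F R t x = 0 := if_neg h
    rw [e]
    exact le_antisymm ((trunc_le _ _ _ _).trans e.le) zero_le

/-- A truncated function has finite norm: its overlap with itself is bounded by `mixed_cut_le`. -/
theorem mixed_trunc_ne_top {q r : ℝ≥0∞} (hq0 : q ≠ 0) (hq : q ≠ ∞) (hr0 : r ≠ 0) (hr : r ≠ ∞)
    (hadm : 2 / q.toReal + (d : ℝ) / r.toReal = d / 2) {F : ℝ → Space d → ℝ≥0∞}
    (hF : Measurable (Function.uncurry F)) (R : ℕ) : mixed q r (trunc F R) ≠ ∞ := by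
  let p : Param d := ⟨1, one_pos, 0, 0, 0⟩
  have h1 := mixed_cut_le hq0 hq hr0 hr hadm F R p p (ρ := p.h) (κ := 2) (Or.inl rfl)
    (by norm_num) (volume_overlapTimes_le_right p p)
  have h2 : cut (tube R p ∩ tube R p) (transport p (trunc F R)) = transport p (trunc F R) := by
    ext t x
    rw [Set.inter_self, cut]
    by_cases h : (t, x) ∈ tube R p
    · rw [Set.indicator_of_mem h]
      rfl
    · rw [Set.indicator_of_notMem h, transport_trunc_eq_zero p F R h]
  rw [h2, mixed_transport_of_admissible p hq0 hq hr0 hr hadm (measurable_trunc hF R)] at h1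
  exact (h1.trans_lt ENNReal.ofReal_lt_top).ne

theorem transport_decomp (p : Param d) (F : ℝ → Space d → ℝ≥0∞) (R : ℕ) :
    transport p F = fun t x => transport p (trunc F R) t x + transport p (truncRest F R) t x := by
  ext t x
  rw [← transport_add]
  congr 1
  ext t x
  exact trunc_add_truncRest _ _ _ _

/-- The pairing of two truncated transported profiles is controlled by their overlap. -/
theorem pairing_transport_trunc_le (hd : 1 ≤ d) (R : ℕ) (p p' : Param d)
    {F G : ℝ → Space d → ℝ≥0∞} (hF : Measurable (Function.uncurry F))
    (hG : Measurable (Function.uncurry G)) {η : ℝ≥0∞}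
    (hov : mixed (diagExp d) (diagExp d)
        (cut (tube R p ∩ tube R p') (transport p (trunc F R))) ≤ η ∨
      mixed (diagExp d) (diagExp d)
        (cut (tube R p ∩ tube R p') (transport p' (trunc G R))) ≤ η) :
    pairing (transport p (trunc F R)) (transport p' (trunc G R)) ≤
      ENNReal.ofReal (tubeConst d R ^ (2 / ((d : ℝ) + 2)) * p.h ^ 2) *
        (η * (mixed (diagExp d) (diagExp d) (trunc F R) +
          mixed (diagExp d) (diagExp d) (trunc G R))) := by
  have hadm := diagExp_admissible hd
  have hp0 := diagExp_ne_zero (d := d)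
  have hp := diagExp_ne_top (d := d)
  set A := tube R p ∩ tube R p' with hA
  have hAm : MeasurableSet A := (measurableSet_tube _ _).inter (measurableSet_tube _ _)
  have mF := measurable_transport p (measurable_trunc hF R)
  have mG := measurable_transport p' (measurable_trunc hG R)
  have eF := mixed_transport_of_admissible p hp0 hp hp0 hp hadm (measurable_trunc hF R)
  have eG := mixed_transport_of_admissible p' hp0 hp hp0 hp hadm (measurable_trunc hG R)
  have hzero : ∀ t x, (t, x) ∉ A →
      transport p (trunc F R) t x * transport p' (trunc G R) t x = 0 := by
    intro t x h
    by_cases h1 : (t, x) ∈ tube R p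
    · rw [transport_trunc_eq_zero p' G R fun h2 => h ⟨h1, h2⟩, mul_zero]
    · rw [transport_trunc_eq_zero p F R h1, zero_mul]
  rcases hov with h | h
  · calc _ ≤ pairing (cut A (transport p (trunc F R))) (transport p' (trunc G R)) := by
          refine pairing_mono fun t x => ?_
          by_cases hx : (t, x) ∈ A
          · simp only [cut, Set.indicator_of_mem hx]
            exact le_rfl
          · rw [hzero t x hx]
            exact zero_le
      _ ≤ _ := pairing_le_of_tube hd R p (measurable_cut hAm mF) mG
          fun t x hx => Set.indicator_of_notMem (fun h => hx h.1) _
      _ ≤ _ := by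
          rw [eG]
          gcongr
          exact le_add_self
  · calc _ ≤ pairing (transport p (trunc F R)) (cut A (transport p' (trunc G R))) := by
          refine pairing_mono fun t x => ?_
          by_cases hx : (t, x) ∈ A
          · simp only [cut, Set.indicator_of_mem hx]
            exact le_rfl
          · rw [hzero t x hx]
            exact zero_le
      _ ≤ _ := pairing_le_of_tube hd R p mF (measurable_cut hAm mG)
          fun t x hx => transport_trunc_eq_zero p F R hx
      _ ≤ _ := by
          rw [eF, mul_comm η]
          gcongr
          exact le_self_add

/-- The pairing of transported functions along orthogonal sequences is `o((h_n)²)`. -/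
theorem eventually_pairing_le (hd : 1 ≤ d) {F G : ℝ → Space d → ℝ≥0∞}
    (hF : Measurable (Function.uncurry F)) (hG : Measurable (Function.uncurry G))
    (hFfin : ∀ t x, F t x ≠ ∞) (hGfin : ∀ t x, G t x ≠ ∞) (hF12 : mixed 1 2 F ≠ ∞)
    (hGP : mixed (diagExp d) (diagExp d) G ≠ ∞) {C : ℝ≥0∞} (hC : C ≠ ∞)
    {Γ Γ' : ℕ → Param d} (horth : Orthogonal Γ Γ')
    (hGC : ∀ n t, eLpNorm (transport (Γ' n) G t) 2 volume ≤ C) {ε : ℝ≥0∞} (hε : ε ≠ 0) :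
    ∀ᶠ n in atTop, pairing (transport (Γ n) F) (transport (Γ' n) G) ≤
      ENNReal.ofReal ((Γ n).h ^ 2) * (ε + ε + ε) := by
  have hadm := diagExp_admissible hd
  have hp0 := diagExp_ne_zero (d := d)
  have hp := diagExp_ne_top (d := d)
  -- truncate `F` in `L¹_t L²_x`; the error is paired with the conserved `L²` norm
  obtain ⟨R, hR⟩ : ∃ R : ℕ, C * mixed 1 2 (truncRest F R) ≤ ε := by
    have h1 := tendsto_mixed_truncRest one_ne_zero ENNReal.one_ne_top two_ne_zero (by norm_num)
      hF hFfin hF12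
    have h2 := ENNReal.Tendsto.const_mul h1 (Or.inr hC)
    rw [mul_zero] at h2
    exact (h2.eventually (ge_mem_nhds (pos_iff_ne_zero.2 hε))).exists
  have hFR : mixed (diagExp d) (diagExp d) (trunc F R) ≠ ∞ :=
    mixed_trunc_ne_top hp0 hp hp0 hp hadm hF R
  set K := ENNReal.ofReal (tubeConst d R ^ (2 / ((d : ℝ) + 2))) with hK
  -- truncate `G` at the diagonal exponent, at a height that depends on the truncation of `F`
  obtain ⟨S, hRS, hS⟩ : ∃ S : ℕ, R ≤ S ∧ K * mixed (diagExp d) (diagExp d) (trunc F R) *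
      mixed (diagExp d) (diagExp d) (truncRest G S) ≤ ε := by
    have h1 := tendsto_mixed_truncRest hp0 hp hp0 hp hG hGfin hGP
    have h2 := ENNReal.Tendsto.const_mul h1
      (Or.inr (ENNReal.mul_ne_top (ENNReal.ofReal_ne_top (r := tubeConst d R ^ (2 / ((d : ℝ) + 2))))
        hFR))
    rw [mul_zero] at h2
    obtain ⟨S, h3, h4⟩ := ((eventually_ge_atTop R).and
      (h2.eventually (ge_mem_nhds (pos_iff_ne_zero.2 hε)))).exists
    exact ⟨S, h3, h4⟩
  set U := trunc F R with hU
  have mU : Measurable (Function.uncurry U) := measurable_trunc hF R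
  have hUS : trunc U S = U := trunc_trunc F hRS
  set K' := ENNReal.ofReal (tubeConst d S ^ (2 / ((d : ℝ) + 2))) with hK'
  obtain ⟨η, hη0, hη⟩ : ∃ η : NNReal, 0 < η ∧ (η : ℝ≥0∞) * (K' * (mixed (diagExp d) (diagExp d) U +
      mixed (diagExp d) (diagExp d) (trunc G S))) < ε :=
    ENNReal.exists_nnreal_pos_mul_lt (ENNReal.mul_ne_top ENNReal.ofReal_ne_top
      (ENNReal.add_ne_top.2 ⟨hFR, mixed_trunc_ne_top hp0 hp hp0 hp hadm hG S⟩)) hε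
  filter_upwards [eventually_overlap_le hd hp0 hp hp0 hp hadm horth U G S (NNReal.coe_pos.2 hη0)]
    with n hn
  have hh := (Γ n).h_pos
  have mTU := measurable_transport (Γ n) mU
  have mTG := measurable_transport (Γ' n) hG
  have mTV := measurable_transport (Γ' n) (measurable_trunc hG S)
  have mTW := measurable_transport (Γ' n) (measurable_truncRest hG S)
  have split : pairing (transport (Γ n) F) (transport (Γ' n) G) =
      (pairing (transport (Γ n) U) (transport (Γ' n) (trunc G S)) +
        pairing (transport (Γ n) U) (transport (Γ' n) (truncRest G S))) +
        pairing (transport (Γ n) (truncRest F R)) (transport (Γ' n) G) := by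
    conv_lhs => rw [transport_decomp (Γ n) F R, pairing_add_left mTU mTG]
    congr 1
    conv_lhs => rw [transport_decomp (Γ' n) G S, pairing_comm, pairing_add_left mTV mTU,
      pairing_comm, pairing_comm (transport (Γ' n) (truncRest G S))]
  have hmulK : ∀ T : ℕ, ENNReal.ofReal (tubeConst d T ^ (2 / ((d : ℝ) + 2)) * (Γ n).h ^ 2) =
      ENNReal.ofReal ((Γ n).h ^ 2) * ENNReal.ofReal (tubeConst d T ^ (2 / ((d : ℝ) + 2))) := by
    intro T
    rw [mul_comm, ENNReal.ofReal_mul (by positivity)]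
  rw [split, mul_add, mul_add]
  refine add_le_add (add_le_add ?_ ?_) ?_
  · rw [ENNReal.ofReal_coe_nnreal, ] at hn
    have h1 := pairing_transport_trunc_le hd S (Γ n) (Γ' n) mU hG hn
    rw [hUS, hmulK, mul_assoc] at h1
    refine h1.trans (mul_le_mul_right ?_ _)
    rw [mul_left_comm]
    exact hη.le
  · have h1 := pairing_le_of_tube hd R (Γ n) mTU mTW
      fun t x hx => transport_trunc_eq_zero (Γ n) F R hx
    rw [mixed_transport_of_admissible _ hp0 hp hp0 hp hadm mU,
      mixed_transport_of_admissible _ hp0 hp hp0 hp hadm (measurable_truncRest hG S), hmulK,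
      mul_assoc, ← mul_assoc (ENNReal.ofReal (tubeConst d R ^ (2 / ((d : ℝ) + 2))))] at h1
    exact h1.trans (mul_le_mul_right hS _)
  · refine (pairing_le_mixed_one_two (measurable_transport _ (measurable_truncRest hF R)) mTG hC
      (hGC n)).trans ?_
    rw [mixed_transport (Γ n) one_ne_zero ENNReal.one_ne_top two_ne_zero (by norm_num)
      (measurable_truncRest hF R), mul_left_comm]
    refine mul_le_mul' (ENNReal.ofReal_le_ofReal (le_of_eq ?_)) hR
    rw [← Real.rpow_two]
    congr 1
    simp

/-! ### Asymptotic orthogonality in `L²` -/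

theorem norm_symm (θ : ℝ) (p : Param d) (f : L2 d) : ‖symm θ p f‖ = ‖f‖ :=
  (symmₗᵢ θ p).norm_map f

theorem norm_propagator (t : ℝ) (f : L2 d) : ‖propagator t f‖ = ‖f‖ :=
  (propagatorₗᵢ t).norm_map f

theorem inner_propagator (t : ℝ) (f g : L2 d) :
    inner ℂ (propagator t f) (propagator t g) = inner ℂ f g :=
  (propagatorₗᵢ t).inner_map_map f g

theorem enorm_inner_le_lintegral (f g : L2 d) : ‖inner ℂ f g‖ₑ ≤ ∫⁻ x, ‖f x‖ₑ * ‖g x‖ₑ := by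
  rw [L2.inner_def]
  refine (enorm_integral_le_lintegral_enorm _).trans (lintegral_mono fun x => ?_)
  rw [RCLike.inner_apply, enorm_mul, mul_comm]
  refine mul_le_mul_left (le_of_eq ?_) _
  exact RCLike.enorm_conj _

/-- Since `⟪e^{itΔ} f, e^{itΔ} g⟫` does not depend on `t`, it equals its average over the time
interval `[t₀, t₀ + h²]`, which is bounded by a space-time pairing. -/
theorem enorm_inner_symm_le_pairing (p p' : Param d) {φ ψ : L2 d} {F G : ℝ → Space d → ℝ≥0∞}
    (hF : ∀ t ∈ Set.Icc (0 : ℝ) 1, ∀ᵐ x, F t x = ‖propagator t φ x‖ₑ)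
    (hG : ∀ t, ∀ᵐ x, G t x = ‖propagator t ψ x‖ₑ) :
    ENNReal.ofReal (p.h ^ 2) * ‖inner ℂ (symm 0 p φ) (symm 0 p' ψ)‖ₑ ≤
      pairing (transport p F) (transport p' G) := by
  have hh := p.h_pos
  have hslice : ∀ t ∈ Set.Icc p.t (p.t + p.h ^ 2), ‖inner ℂ (symm 0 p φ) (symm 0 p' ψ)‖ₑ ≤
      ∫⁻ x, transport p F t x * transport p' G t x := by
    intro t ht
    rw [← inner_propagator t]
    refine (enorm_inner_le_lintegral _ _).trans_eq (lintegral_congr_ae ?_)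
    have hs : (t - p.t) / p.h ^ 2 ∈ Set.Icc (0 : ℝ) 1 := by
      refine ⟨div_nonneg (by linarith [ht.1]) (by positivity), ?_⟩
      rw [div_le_one (by positivity)]
      linarith [ht.2]
    have h1 : ∀ᵐ x, transport p F t x = ‖propagator t (symm 0 p φ) x‖ₑ := by
      filter_upwards [norm_propagator_symm_ae 0 p φ t,
        (quasiMeasurePreserving_affine p.h_pos (p.x + (2 * t) • p.ξ)).ae (hF _ hs)] with x h1 h2
      rw [transport, h2, ← ofReal_norm, ← ofReal_norm, h1, ENNReal.ofReal_mul]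
      positivity
    filter_upwards [h1, transport_eq_enorm_ae p' hG t] with x e1 e2
    rw [e1, e2]
  calc _ = ∫⁻ _t in Set.Icc p.t (p.t + p.h ^ 2), ‖inner ℂ (symm 0 p φ) (symm 0 p' ψ)‖ₑ := by
        rw [setLIntegral_const, Real.volume_Icc, add_sub_cancel_left, mul_comm]
    _ ≤ ∫⁻ t in Set.Icc p.t (p.t + p.h ^ 2), ∫⁻ x, transport p F t x * transport p' G t x :=
        setLIntegral_mono' measurableSet_Icc hslice
    _ ≤ _ := setLIntegral_le_lintegral _ _

theorem eLpNorm_two_eq_enorm {f : L2 d} {g : Space d → ℝ≥0∞} (h : ∀ᵐ x, g x = ‖f x‖ₑ) :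
    eLpNorm g 2 volume = ‖f‖ₑ := by
  rw [Lp.enorm_def, ← eLpNorm_enorm (f := f)]
  exact eLpNorm_congr_ae h

/-- Asymptotic orthogonality in `L²`, when one of the profiles has an evolution in the diagonal
Strichartz space. -/
theorem tendsto_inner_of_mixedNorm_ne_top (hd : 1 ≤ d) {Γ Γ' : ℕ → Param d}
    (horth : Orthogonal Γ Γ') (φ : L2 d) {ψ : L2 d}
    (hψ : mixedNorm (diagExp d) (diagExp d) (fun t => propagator t ψ) ≠ ∞) :
    Tendsto (fun n => inner ℂ (symm 0 (Γ n) φ) (symm 0 (Γ' n) ψ)) atTop (𝓝 0) := by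
  obtain ⟨F, hF, hFfin, hFe⟩ := exists_modulus φ
  obtain ⟨G, hG, hGfin, hGe⟩ := exists_modulus ψ
  rw [mixedNorm_eq_mixed hGe] at hψ
  -- restriction to unit time puts the modulus of an arbitrary profile into `L¹_t L²_x`
  set I : Set (ℝ × Space d) := {z | z.1 ∈ Set.Icc (0 : ℝ) 1} with hI
  have hIm : MeasurableSet I := measurable_fst measurableSet_Icc
  have hF1 : ∀ t ∈ Set.Icc (0 : ℝ) 1, ∀ x, cut I F t x = F t x := fun t ht x =>
    Set.indicator_of_mem (s := I) ht _
  have hF0 : ∀ t, t ∉ Set.Icc (0 : ℝ) 1 → ∀ x, cut I F t x = 0 := fun t ht x =>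
    Set.indicator_of_notMem (s := I) ht _
  have h12 : mixed 1 2 (cut I F) ≠ ∞ := by
    rw [mixed, eLpNorm_one_eq_lintegral_enorm]
    have : ∀ t, ‖eLpNorm (cut I F t) 2 volume‖ₑ ≤
        (Set.Icc (0 : ℝ) 1).indicator (fun _ => ‖φ‖ₑ) t := by
      intro t
      rw [enorm_eq_self]
      by_cases ht : t ∈ Set.Icc (0 : ℝ) 1
      · rw [Set.indicator_of_mem ht, eLpNorm_two_eq_enorm (f := propagator t φ)]
        · rw [← ofReal_norm, norm_propagator, ofReal_norm]
        · filter_upwards [hFe t] with x hx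
          rw [hF1 t ht, hx]
      · have e : cut I F t = 0 := funext (hF0 t ht)
        rw [e, eLpNorm_zero]
        exact zero_le
    refine ((lintegral_mono this).trans_lt ?_).ne
    rw [lintegral_indicator_const measurableSet_Icc, Real.volume_Icc]
    exact ENNReal.mul_lt_top enorm_lt_top ENNReal.ofReal_lt_top
  have hGC : ∀ n t, eLpNorm (transport (Γ' n) G t) 2 volume ≤ ‖ψ‖ₑ := by
    intro n t
    rw [eLpNorm_two_eq_enorm (transport_eq_enorm_ae (Γ' n) hGe t), ← ofReal_norm, norm_propagator,
      norm_symm, ofReal_norm]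
  rw [tendsto_zero_iff_enorm_tendsto_zero, ENNReal.tendsto_nhds_zero]
  intro ε hε
  have hε3 : ε / 3 ≠ 0 := (ENNReal.div_pos hε.ne' (by norm_num)).ne'
  filter_upwards [eventually_pairing_le hd (measurable_cut hIm hF) hG
    (fun t x => ((cut_le I F t x).trans_lt (hFfin t x).lt_top).ne) hGfin h12 hψ enorm_ne_top horth
    hGC hε3] with n hn
  have h1 := (enorm_inner_symm_le_pairing (Γ n) (Γ' n) (φ := φ) (ψ := ψ) (F := cut I F) (G := G)
    (fun t ht => by
      filter_upwards [hFe t] with x hx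
      rw [hF1 t ht, hx]) hGe).trans hn
  rw [ENNReal.add_thirds] at h1
  have hh := (Γ n).h_pos
  exact (ENNReal.mul_le_mul_iff_right (ENNReal.ofReal_pos.2 (pow_pos hh 2)).ne'
    ENNReal.ofReal_ne_top).1 h1

/-- Asymptotic orthogonality in `L²`. -/
theorem tendsto_inner_symm (hd : 1 ≤ d) {Γ Γ' : ℕ → Param d} (horth : Orthogonal Γ Γ')
    (φ ψ : L2 d) :
    Tendsto (fun n => inner ℂ (symm 0 (Γ n) φ) (symm 0 (Γ' n) ψ)) atTop (𝓝 0) := by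
  have hspan : ∀ χ ∈ gaussianSpan d,
      Tendsto (fun n => inner ℂ (symm 0 (Γ n) φ) (symm 0 (Γ' n) χ)) atTop (𝓝 0) := by
    intro χ hχ
    induction hχ using Submodule.span_induction with
    | mem χ h =>
      obtain ⟨ξ, rfl⟩ := h
      refine tendsto_inner_of_mixedNorm_ne_top hd horth φ ?_
      unfold mixedNorm
      simp only [eLpNorm_propagator_modulate diagExp_ne_top]
      exact mixedNorm_gaussianL2_ne_top hd
    | zero =>
      have : ∀ n, symm 0 (Γ' n) (0 : L2 d) = 0 := fun n => (symmₗᵢ 0 (Γ' n)).map_zero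
      simp [this]
    | add χ χ' _ _ h h' =>
      have : ∀ n, symm 0 (Γ' n) (χ + χ') = symm 0 (Γ' n) χ + symm 0 (Γ' n) χ' :=
        fun n => (symmₗᵢ 0 (Γ' n)).map_add χ χ'
      simpa [this, inner_add_right] using h.add h'
    | smul c χ _ h =>
      have : ∀ n, symm 0 (Γ' n) (c • χ) = c • symm 0 (Γ' n) χ :=
        fun n => (symmₗᵢ 0 (Γ' n)).map_smul c χ
      simpa [this, inner_smul_right] using h.const_mul c
  -- the operators are isometric, so convergence on a dense set suffices
  rw [Metric.tendsto_atTop']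
  intro ε hε
  obtain ⟨χ, hχ, hdist⟩ := Metric.dense_iff.1 dense_gaussianSpan ψ (ε / (2 * (‖φ‖ + 1)))
    (by positivity)
  obtain ⟨n₀, hn₀⟩ := (Metric.tendsto_atTop'.1 (hspan χ hdist)) (ε / 2) (by positivity)
  refine ⟨n₀, fun n hn => ?_⟩
  have h1 := hn₀ n hn
  rw [dist_zero_right] at h1 ⊢
  have hsub : symm 0 (Γ' n) ψ = symm 0 (Γ' n) (ψ - χ) + symm 0 (Γ' n) χ := by
    have := (symmₗᵢ 0 (Γ' n)).map_add (ψ - χ) χ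
    rw [sub_add_cancel] at this
    exact this
  rw [hsub, inner_add_right]
  refine (norm_add_le _ _).trans_lt ?_
  have h2 : ‖inner ℂ (symm 0 (Γ n) φ) (symm 0 (Γ' n) (ψ - χ))‖ ≤ ‖φ‖ * ‖ψ - χ‖ := by
    refine (norm_inner_le_norm _ _).trans_eq ?_
    rw [norm_symm, norm_symm]
  have h3 : ‖φ‖ * ‖ψ - χ‖ ≤ ε / 2 := by
    rw [Metric.mem_ball, dist_comm, dist_eq_norm, lt_div_iff₀ (by positivity)] at hχ
    nlinarith [norm_nonneg (ψ - χ), norm_nonneg φ]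
  linarith

/-- The `L^∞_t L²_x` norm of a curve of constant norm. -/
theorem mixedNorm_top_two {u : ℝ → L2 d} {f : L2 d} (h : ∀ t, ‖u t‖ = ‖f‖) :
    mixedNorm ∞ 2 u = ‖f‖ₑ := by
  have : ∀ t, eLpNorm (u t) 2 volume = ‖f‖ₑ := fun t => by
    rw [← Lp.enorm_def, ← ofReal_norm, h, ofReal_norm]
  simp only [mixedNorm, this]
  rw [eLpNorm_exponent_top, eLpNormEssSup_const _ (NeZero.ne _), enorm_eq_self]

/-- Decoupling at `(∞, 2)`: the flow is unitary, so the norm is the `L²` norm of the data, and the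
cross terms of its square tend to zero. -/
theorem limsup_mixedNorm_top_two_le (hd : 1 ≤ d) {ι : Type*} [Fintype ι] (φ : ι → L2 d)
    {Γ : ι → ℕ → Param d} (horth : ∀ j k, j ≠ k → Orthogonal (Γ j) (Γ k)) :
    limsup (fun n => mixedNorm ∞ 2 (fun t => ∑ j, propagator t (symm 0 (Γ j n) (φ j))) ^ (2 : ℝ))
      atTop ≤ ∑ j, mixedNorm ∞ 2 (fun t => propagator t (φ j)) ^ (2 : ℝ) := by
  classical
  have e1 : ∀ n, mixedNorm ∞ 2 (fun t => ∑ j, propagator t (symm 0 (Γ j n) (φ j))) ^ (2 : ℝ) =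
      ENNReal.ofReal (‖∑ j, symm 0 (Γ j n) (φ j)‖ ^ 2) := by
    intro n
    rw [mixedNorm_top_two (f := ∑ j, symm 0 (Γ j n) (φ j)), ← ofReal_norm, ENNReal.rpow_two,
      ENNReal.ofReal_pow (norm_nonneg _)]
    intro t
    have : ∑ j, propagator t (symm 0 (Γ j n) (φ j)) =
        propagator t (∑ j, symm 0 (Γ j n) (φ j)) :=
      (map_sum (propagatorₗᵢ t) _ _).symm
    rw [this, norm_propagator]
  have e2 : ∑ j, mixedNorm ∞ 2 (fun t => propagator t (φ j)) ^ (2 : ℝ) =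
      ENNReal.ofReal (∑ j, ‖φ j‖ ^ 2) := by
    rw [ENNReal.ofReal_sum_of_nonneg fun j _ => by positivity]
    refine Finset.sum_congr rfl fun j _ => ?_
    rw [mixedNorm_top_two (f := φ j) fun t => norm_propagator t _, ← ofReal_norm, ENNReal.rpow_two,
      ENNReal.ofReal_pow (norm_nonneg _)]
  have e3 : ∀ n, ‖∑ j, symm 0 (Γ j n) (φ j)‖ ^ 2 =
      ∑ j, ∑ k, RCLike.re (inner ℂ (symm 0 (Γ j n) (φ j)) (symm 0 (Γ k n) (φ k))) := by
    intro n
    rw [← inner_self_eq_norm_sq (𝕜 := ℂ), sum_inner, map_sum]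
    refine Finset.sum_congr rfl fun j _ => ?_
    rw [inner_sum, map_sum]
  have h1 : Tendsto (fun n => ‖∑ j, symm 0 (Γ j n) (φ j)‖ ^ 2) atTop (𝓝 (∑ j, ‖φ j‖ ^ 2)) := by
    have e4 : ∑ j, ‖φ j‖ ^ 2 = ∑ j, ∑ k, if j = k then ‖φ j‖ ^ 2 else 0 := by simp
    rw [e4]
    simp only [e3]
    refine tendsto_finsetSum _ fun j _ => tendsto_finsetSum _ fun k _ => ?_
    by_cases hjk : j = k
    · subst hjk
      rw [if_pos rfl]
      refine tendsto_const_nhds.congr fun n => ?_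
      rw [inner_self_eq_norm_sq, norm_symm]
    · rw [if_neg hjk]
      have := (RCLike.continuous_re (K := ℂ)).tendsto 0 |>.comp
        (tendsto_inner_symm hd (horth j k hjk) (φ j) (φ k))
      simpa [Function.comp_def] using this
  simp only [e1]
  rw [e2]
  exact (ENNReal.tendsto_ofReal h1).limsup_eq.le

end SchrodingerProfile

end

open SchrodingerProfile in
theorem mainTheorem5 (d : ℕ) (hd : 1 ≤ d) (q r : ℝ≥0∞)
    (hadm : Admissible d q r) (hne : ¬ IsEndpoint d q r)
    (N : ℕ) (hN : 1 ≤ N) (φ : Fin N → L2 d) (Γ : Fin N → ℕ → Param d)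
    (horth : ∀ j k : Fin N, j ≠ k → Orthogonal (Γ j) (Γ k)) :
    (r ≤ q →
      limsup (fun n : ℕ =>
          mixedNorm q r (fun t => ∑ j, propagator t (symm 0 (Γ j n) (φ j))) ^ r.toReal) atTop
        ≤ ∑ j, mixedNorm q r (fun t => propagator t (φ j)) ^ r.toReal) ∧
    (q ≤ r →
      limsup (fun n : ℕ =>
          mixedNorm q r (fun t => ∑ j, propagator t (symm 0 (Γ j n) (φ j))) ^ q.toReal) atTop
        ≤ ∑ j, mixedNorm q r (fun t => propagator t (φ j)) ^ q.toReal) := by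
  obtain ⟨heq, h2d, hq2, hr2⟩ := hadm
  have hd0 : (0 : ℝ) < d := by exact_mod_cast hd
  have hq0 : q ≠ 0 := (two_pos.trans_le hq2).ne'
  have hr0 : r ≠ 0 := (two_pos.trans_le hr2).ne'
  have hq1 : 1 ≤ q := one_le_two.trans hq2
  have hr1 : 1 ≤ r := one_le_two.trans hr2
  have hreal : 2 / q.toReal + (d : ℝ) / r.toReal = d / 2 := by
    have h := congrArg ENNReal.toReal heq
    rw [ENNReal.toReal_add (ENNReal.div_ne_top (by norm_num) hq0)
      (ENNReal.div_ne_top (by simp) hr0)] at h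
    simpa [ENNReal.toReal_div] using h
  -- the only pairs with `r = ∞` are `(2, ∞)` for `d = 2` and the endpoint `(4, ∞)` for `d = 1`
  have hr : r ≠ ∞ := by
    rintro rfl
    rw [ENNReal.toReal_top, div_zero, add_zero] at hreal
    have hq : q ≠ ∞ := by
      rintro rfl
      rw [ENNReal.toReal_top, div_zero] at hreal
      linarith
    have hqpos : 0 < q.toReal := ENNReal.toReal_pos hq0 hq
    have hqd : q.toReal * d = 4 := by
      field_simp at hreal
      linarith
    have hq2' : 2 ≤ q.toReal := by
      have := ENNReal.toReal_mono hq hq2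
      simpa using this
    have hd2 : d ≤ 2 := by
      have : (d : ℝ) ≤ 2 := by nlinarith
      exact_mod_cast this
    interval_cases d
    · refine hne (Or.inr ⟨rfl, ?_, rfl⟩)
      rw [← ENNReal.ofReal_toReal hq]
      have : q.toReal = 4 := by simpa using hqd
      rw [this]
      norm_num
    · refine h2d ⟨?_, rfl, rfl⟩
      rw [← ENNReal.ofReal_toReal hq]
      have : q.toReal = 2 := by
        push_cast at hqd
        linarith
      rw [this]
      norm_num
  by_cases hq : q = ∞
  · subst hq
    rw [ENNReal.toReal_top, div_zero, zero_add] at hreal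
    have hrr : r = 2 := by
      have hrpos : 0 < r.toReal := ENNReal.toReal_pos hr0 hr
      have : r.toReal = 2 := by
        field_simp at hreal
        linarith
      rw [← ENNReal.ofReal_toReal hr, this]
      norm_num
    subst hrr
    refine ⟨fun _ => ?_, fun h => absurd (top_le_iff.1 h) hr⟩
    simpa using limsup_mixedNorm_top_two_le hd φ horth
  · have h := limsup_mixedNorm_le hd hq1 hq hr1 hr hreal φ horth
    refine ⟨fun hrq => ?_, fun hqr => ?_⟩
    · rwa [min_eq_right hrq] at h
    · rwa [min_eq_left hqr] at h
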